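/- Write $[U]=\{1,\dots,U\}$. In the set intersection problem $\mathsf{SetInt}_{U,k,l}$ Alice gets a $k$-subset $X$ of $[U]$, Bob gets an $l$-subset $Y$ of $[U]$, and both players must learn $X\cap Y$. A Las Vegas Two-Phase protocol is a randomized communication protocol with a public coin and a private coin for each player (the three coins being independent), given by binary protocol trees selected by the public coin, such that: - on every input $(x,y)$ with $|x|=k$ and $|y|=l$, with probability one over the coins, the protocol halts and both players answer $x\cap y$; - on every root-to-leaf path exactly one node is marked as the phase-transition node. Bits sent before this node is reached belong to phase one, all later bits belong to phase two. Let $\mathcal U_{U,k,l}$ be the law of $(X,Y)$, where $X$ is a uniformly random $k$-subset and $Y$ an independent uniformly random $l$-subset of $[U]$. The cost $C(P,\mathcal U_{U,k,l})=(a_1,b_1,a_2,b_2)$ of a protocol $P$ consists of the expected numbers (over the inputs and the coins) of bits sent in phase one by Alice and by Bob, and in phase two by Alice and by Bob. Lemma. For $l\gg k$, $U\gg l$ and any $r>1$, no Las Vegas Two-Phase protocol $P$ for $\mathsf{SetInt}_{U,k,l}$ has $C(P,\mathcal U_{U,k,l})=(o(k),o(l),o(k\log r),o(k/r))$. That is,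 there are absolute constants $\varepsilon>0$ and $C$ such that for all integers $k\ge 1$, $l$ and $U$ with $k\le U$, $l\le U$, $l\ge Ck$ and $U\ge Cl$, for every real $r>1$, and for every Las Vegas Two-Phase protocol $P$ for $\mathsf{SetInt}_{U,k,l}$ with $C(P,\mathcal U_{U,k,l})=(a_1,b_1,a_2,b_2)$, the four inequalities \[ a_1\le \varepsilon k,\qquad b_1\le \varepsilon l,\qquad a_2\le \varepsilon k\log_2 r,\qquad b_2\le \varepsilon k/r \] do not all hold. -/

import Mathlib

open MeasureTheory
open scoped ENNReal

universe u

/-- The two players. -/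
inductive Player where
  | alice
  | bob

/-- The two phases of a Two-Phase protocol. -/
inductive Phase where
  | one
  | two

/-- A deterministic binary protocol tree, possibly infinite. Alice has an input in `α`, Bob has an
input in `β`, and both players give an answer in `γ`. A node is named by the bits written on the
path from the root to it. `node v = some p` means that player `p` sends the next bit at `v`, and
`node v = none` means that `v` is a leaf (what lies below a leaf is not part of the tree). At a leaf
each player answers as a function of the transcript and of the player's own input. -/
structure ProtocolTree (α β γ : Type*) where
  node : List Bool → Option Player
  bitA : List Bool → α → Bool
  bitB : List Bool → β → Bool
  outA : List Bool → α → γ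
  outB : List Bool → β → γ

namespace ProtocolTree

variable {α β γ : Type*}

/-- `v` is a leaf of the tree: it is labelled as a leaf and no proper ancestor is. -/
def IsLeaf (T : ProtocolTree α β γ) (v : List Bool) : Prop :=
  T.node v = none ∧ ∀ u, u <+: v → u ≠ v → T.node u ≠ none

/-- One round of communication from the transcript `v`. Nothing happens at a leaf. -/
def step (T : ProtocolTree α β γ) (x : α) (y : β) (v : List Bool) : List Bool :=
  match T.node v with
  | none => v
  | some Player.alice => v ++ [T.bitA v x]
  | some Player.bob => v ++ [T.bitB v y]

/-- The transcript after `n` rounds on the input `(x, y)`. -/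
def run (T : ProtocolTree α β γ) (x : α) (y : β) (n : ℕ) : List Bool :=
  (T.step x y)^[n] []

/-- On the input `(x, y)` the protocol reaches a leaf, and there both players answer `z`. -/
def BothOutput (T : ProtocolTree α β γ) (x : α) (y : β) (z : γ) : Prop :=
  ∃ n, T.node (T.run x y n) = none ∧
    T.outA (T.run x y n) x = z ∧ T.outB (T.run x y n) y = z

end ProtocolTree

/-- A protocol tree with marked phase-transition nodes, exactly one on every root-to-leaf path. -/
structure TwoPhaseTree (α β γ : Type*) extends ProtocolTree α β γ where
  marked : Set (List Bool)
  marked_unique : ∀ v, toProtocolTree.IsLeaf v → ∃! u, u <+: v ∧ u ∈ marked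

namespace TwoPhaseTree

variable {α β γ : Type*}

open Classical in
/-- The phase to which a bit sent at the node `v` belongs: phase two from the phase-transition
node on, phase one before it. -/
noncomputable def phase (T : TwoPhaseTree α β γ) (v : List Bool) : Phase :=
  if ∃ u, u <+: v ∧ u ∈ T.marked then Phase.two else Phase.one

open Classical in
/-- The number of bits (possibly `∞`) which player `p` sends in phase `i` on the input `(x, y)`. -/
noncomputable def bits (T : TwoPhaseTree α β γ) (p : Player) (i : Phase) (x : α) (y : β) : ℝ≥0∞ :=
  ∑' n : ℕ, if T.node (T.run x y n) = some p ∧ T.phase (T.run x y n) = i then 1 else 0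

end TwoPhaseTree

/-- A randomized Two-Phase protocol with public coins and with private coins for each player. The
three coins are independent, with arbitrary laws. The value of the public coin selects a
Two-Phase tree, in which Alice acts on her input and her private coin, and Bob on his input and his
private coin. -/
structure TwoPhaseProtocol (α β γ : Type*) where
  Pub : Type u
  CoinA : Type u
  CoinB : Type u
  [measPub : MeasurableSpace Pub]
  [measA : MeasurableSpace CoinA]
  [measB : MeasurableSpace CoinB]
  lawPub : Measure Pub
  lawA : Measure CoinA
  lawB : Measure CoinB
  [probPub : IsProbabilityMeasure lawPub]
  [probA : IsProbabilityMeasure lawA]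
  [probB : IsProbabilityMeasure lawB]
  tree : Pub → TwoPhaseTree (α × CoinA) (β × CoinB) γ
  measurableSet_node : ∀ v s, MeasurableSet {ω | (tree ω).node v = s}
  measurableSet_marked : ∀ v, MeasurableSet {ω | v ∈ (tree ω).marked}
  measurable_bitA : ∀ v x, Measurable fun ω : Pub × CoinA => (tree ω.1).bitA v (x, ω.2)
  measurable_bitB : ∀ v y, Measurable fun ω : Pub × CoinB => (tree ω.1).bitB v (y, ω.2)

namespace TwoPhaseProtocol

variable {α β γ : Type*}

attribute [instance] measPub measA measB probPub probA probB

/-- The joint law of the public coin and the two private coins. -/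
noncomputable def law (P : TwoPhaseProtocol.{u} α β γ) : Measure (P.Pub × P.CoinA × P.CoinB) :=
  P.lawPub.prod (P.lawA.prod P.lawB)

/-- On the input `(x, y)`, with probability one, the protocol halts and both players answer `z`. -/
def ZeroError (P : TwoPhaseProtocol.{u} α β γ) (x : α) (y : β) (z : γ) : Prop :=
  ∀ᵐ ω ∂P.law, (P.tree ω.1).BothOutput (x, ω.2.1) (y, ω.2.2) z

/-- The expected number of bits which player `p` sends in phase `i` on the input `(x, y)`. -/
noncomputable def costOn (P : TwoPhaseProtocol.{u} α β γ) (p : Player) (i : Phase)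
    (x : α) (y : β) : ℝ≥0∞ :=
  ∫⁻ ω, (P.tree ω.1).bits p i (x, ω.2.1) (y, ω.2.2) ∂P.law

/-- The expected number of bits which player `p` sends in phase `i` when the pair of inputs has
law `μ`. -/
noncomputable def cost (P : TwoPhaseProtocol.{u} α β γ) (μ : PMF (α × β))
    (p : Player) (i : Phase) : ℝ≥0∞ :=
  ∑' z : α × β, μ z * P.costOn p i z.1 z.2

end TwoPhaseProtocol

/-- `P` is a Las Vegas protocol for set intersection: for every `k`-subset `x` and `l`-subset `y`
of the universe `Fin U`, both players learn `x ∩ y` without error. -/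
def SolvesSetInt (U k l : ℕ)
    (P : TwoPhaseProtocol.{u} (Finset (Fin U)) (Finset (Fin U)) (Finset (Fin U))) : Prop :=
  ∀ x y : Finset (Fin U), x.card = k → y.card = l → P.ZeroError x y (x ∩ y)

/-- The law of two independent sets, a uniform `k`-subset and a uniform `l`-subset of `Fin U`. -/
noncomputable def unifSetInt (U k l : ℕ) (hk : k ≤ U) (hl : l ≤ U) :
    PMF (Finset (Fin U) × Finset (Fin U)) :=
  PMF.uniformOfFinset
    (Finset.powersetCard k (Finset.univ : Finset (Fin U)) ×ˢ
      Finset.powersetCard l (Finset.univ : Finset (Fin U)))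
    (Finset.Nonempty.product
      (Finset.powersetCard_nonempty.2 (by simpa using hk))
      (Finset.powersetCard_nonempty.2 (by simpa using hl)))

/-! Fix the coins so that each of the four average costs is at most four times its assumed bound
(`exists_tree`), and replace uniform sets by uniform injective sequences, so that the chain rule
splits information over the entries. Let `u` be the transcript of phase one and `w` the whole
transcript. Both have rectangular classes, and the mean decrease of the logarithm of a player's
class size is at most `log 2` times the mean number of bits which that player sends
(`sum_log_card_fib_sub_le`).

Compare entry `j` of Alice's sequence `x` with entry `i` of Bob's sequence `y`, each given the
earlier entries of its own sequence. In phase one Bob reveals little about a typical `y i`, so `y i`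
still takes all but few values with probability more than `1 / (4 * U)`. The exceptional values are
`sparse`; `x j` is rarely one of them, because Alice too reveals little about `x j` in phase one. It
is also rarely in `y`, because `l / U` is small. So `x j` usually lies in the set `D` of values that
are not sparse, not common to `x` and `y`, and still possible for it at the end.

Bob's `y i` cannot lie in `D`: otherwise some sequence in Alice's final class would share `y i` with
`y`, and by rectangularity the known intersection would contain `y i`. Hence phase two has removed
probability at least `#D / (4 * U)` from `y i`, and this bounds Bob's information from below. If Bob
sends only `ε * k / r` bits in phase two, then since `k ≤ l` the set `D` has mean density `O(ε /
r)`. To place `x j` in so thin a set costs Alice about `log r` per entry, hence about `k * log r` in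
total, which is more than she may send.

Each comparison of information with probability is an instance of `sum_test_le`, with `c` equal to
`-1/2`, `1`, `-1` and `M`, where `M` is of order `r`. `coordinate_bound` combines them for one pair
`(i, j)`, `partition_bound` sums over the pairs, and `not_cheap` inserts the numbers. -/

namespace SetIntBound

open Finset Real
open scoped Classical

/-! ### Relative entropy between uniform laws on finite sets -/

/-- The elements of `A` on which `p` takes the same value as at `x`. -/
noncomputable def fib {Ω V : Type*} (A : Finset Ω) (p : Ω → V) (x : Ω) : Finset Ω :=
  A.filter fun x' => p x' = p x

/-- The mean of `f` over `fib B p x`. -/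
noncomputable def condMean {Ω V : Type*} (B : Finset Ω) (p : Ω → V) (f : Ω → ℝ) (x : Ω) : ℝ :=
  (∑ x' ∈ fib B p x, f x') / #(fib B p x)

/-- The pointwise log-likelihood ratio, between the uniform laws on `A` and on `B`, of `q` given
`p`. -/
noncomputable def infoGain {Ω V W : Type*} (A B : Finset Ω) (p : Ω → V) (q : Ω → W) (x : Ω) : ℝ :=
  (log #(fib A q x) - log #(fib A p x)) - (log #(fib B q x) - log #(fib B p x))

section Fibers

variable {Ω V W : Type*}

lemma mem_fib {A : Finset Ω} {p : Ω → V} {x x' : Ω} : x' ∈ fib A p x ↔ x' ∈ A ∧ p x' = p x := by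
  simp [fib]

lemma fib_congr {A : Finset Ω} {p : Ω → V} {x x' : Ω} (h : p x = p x') :
    fib A p x = fib A p x' := by
  simp [fib, h]

lemma self_mem_fib {A : Finset Ω} {p : Ω → V} {x : Ω} (h : x ∈ A) : x ∈ fib A p x :=
  mem_fib.2 ⟨h, rfl⟩

lemma card_fib_pos {A : Finset Ω} {p : Ω → V} {x : Ω} (h : x ∈ A) : 0 < (#(fib A p x) : ℝ) := by
  exact_mod_cast card_pos.2 ⟨x, self_mem_fib h⟩

lemma sum_sum_fib (A B : Finset Ω) (p : Ω → V) (h : Ω → ℝ) :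
    ∑ x ∈ A, ∑ x' ∈ fib B p x, h x' = ∑ x' ∈ B, #(fib A p x') * h x' := by
  have h1 : ∀ x ∈ A, ∑ x' ∈ fib B p x, h x' = ∑ x' ∈ B, if p x' = p x then h x' else 0 := by
    intro x _
    rw [fib, sum_filter]
  rw [sum_congr rfl h1, sum_comm]
  refine sum_congr rfl fun x' _ => ?_
  rw [← nsmul_eq_mul, ← sum_const, fib, sum_filter]
  refine sum_congr rfl fun x _ => ?_
  simp only [eq_comm]

lemma sum_condMean (A B : Finset Ω) (p : Ω → V) (f : Ω → ℝ) :
    ∑ x ∈ A, condMean B p f x = ∑ x ∈ B, f x * #(fib A p x) / #(fib B p x) := by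
  have h1 : ∀ x ∈ A, condMean B p f x = ∑ x' ∈ fib B p x, f x' / #(fib B p x') := by
    intro x _
    rw [condMean, sum_div]
    refine sum_congr rfl fun x' hx' => ?_
    rw [fib_congr (mem_fib.1 hx').2]
  rw [sum_congr rfl h1, sum_sum_fib]
  exact sum_congr rfl fun x _ => by ring

lemma sum_condMean_self (A : Finset Ω) (p : Ω → V) (f : Ω → ℝ) :
    ∑ x ∈ A, condMean A p f x = ∑ x ∈ A, f x := by
  rw [sum_condMean]
  refine sum_congr rfl fun x hx => ?_
  have := card_fib_pos (p := p) hx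
  field_simp

/-- Gibbs' inequality: the mean of `infoGain` over `A` is a conditional relative entropy, and `log t
≤ t - 1`, applied to `f` divided by the likelihood ratio, bounds it below by any admissible test
function `f`. -/
lemma sum_log_add_one_sub_condMean_le {A B : Finset Ω} (hAB : A ⊆ B) {p : Ω → V} {q : Ω → W}
    (hqp : ∀ x x', q x = q x' → p x = p x') {f : Ω → ℝ} (hf : ∀ x ∈ B, 0 ≤ f x)
    (hfA : ∀ x ∈ A, 0 < f x) (hfq : ∀ x x', q x = q x' → f x = f x') :
    ∑ x ∈ A, (log (f x) + 1 - condMean B p f x) ≤ ∑ x ∈ A, infoGain A B p q x := by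
  -- `h` is chosen so that `#(fib B q x) * h x` is `f x` divided by the likelihood ratio `exp
  -- (infoGain A B p q x)`.
  set h : Ω → ℝ := fun x => f x * #(fib A p x) / (#(fib A q x) * #(fib B p x)) with hh
  have hcong : ∀ x x', q x = q x' → h x = h x' := by
    intro x x' e
    simp only [hh, hfq _ _ e, fib_congr (hqp _ _ e), fib_congr e]
  have h1 : ∀ x ∈ A, log (f x) + 1 - infoGain A B p q x ≤ ∑ x' ∈ fib B q x, h x' := by
    intro x hx
    have e1 := card_fib_pos (p := p) hx
    have e2 := card_fib_pos (p := q) hx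
    have e3 := card_fib_pos (p := p) (hAB hx)
    have e4 := card_fib_pos (p := q) (hAB hx)
    have hs : ∑ x' ∈ fib B q x, h x' = #(fib B q x) * h x := by
      rw [← nsmul_eq_mul, ← sum_const]
      exact sum_congr rfl fun x' hx' => hcong _ _ (mem_fib.1 hx').2
    have hfx := hfA x hx
    have hpos : 0 < #(fib B q x) * h x := by simp only [hh]; positivity
    have hl : log (#(fib B q x) * h x) = log (f x) - infoGain A B p q x := by
      simp only [hh, infoGain]
      rw [log_mul e4.ne' (by positivity), log_div (by positivity) (by positivity),
        log_mul hfx.ne' e1.ne', log_mul e2.ne' e3.ne']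
      ring
    rw [hs]
    linarith [log_le_sub_one_of_pos hpos]
  have h2 : ∑ x ∈ A, ∑ x' ∈ fib B q x, h x' ≤ ∑ x ∈ A, condMean B p f x := by
    rw [sum_sum_fib, sum_condMean]
    refine sum_le_sum fun x hx => ?_
    have e3 := card_fib_pos (p := p) hx
    have := hf x hx
    -- Elements of `B` whose `q`-class misses `A` contribute nothing on the left; this is the only
    -- loss here.
    rcases (Nat.cast_nonneg (α := ℝ) #(fib A q x)).eq_or_lt with e | e
    · rw [← e, zero_mul]; positivity
    · refine le_of_eq ?_
      simp only [hh]
      field_simp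
  have h3 := sum_le_sum h1
  simp only [sum_sub_distrib, sum_add_distrib] at h3 ⊢
  linarith

lemma sum_le_sum_of_fib [Fintype Ω] (p : Ω → V) {F G : Ω → ℝ}
    (h : ∀ x, ∑ x' ∈ fib univ p x, F x' ≤ ∑ x' ∈ fib univ p x, G x') : ∑ x, F x ≤ ∑ x, G x := by
  have hm : ∀ x ∈ (univ : Finset Ω), p x ∈ univ.image p := fun x hx => mem_image_of_mem p hx
  rw [← sum_fiberwise_of_maps_to hm, ← sum_fiberwise_of_maps_to hm]
  refine sum_le_sum fun v hv => ?_
  obtain ⟨x, -, rfl⟩ := mem_image.1 hv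
  exact h x

/-- Learning a function which is constant on the classes of `P ∧ ¬ Q` and two-valued on the classes
of `P ∧ Q` reduces the logarithm of the size of the class by at most `log 2` on average. -/
lemma sum_log_card_fib_sub_le [Fintype Ω] (R : Ω → V) (R' : Ω → W) (b : Ω → Bool)
    (P Q : V → Prop) (h1 : ∀ x x', Q (R x) → R x = R x' → b x = b x' → R' x = R' x')
    (h2 : ∀ x x', ¬ Q (R x) → R x = R x' → R' x = R' x')
    (h3 : ∀ x x', R' x = R' x' → R x = R x') :
    ∑ x, (if P (R x) then log #(fib univ R x) - log #(fib univ R' x) else 0) ≤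
      ∑ x, (if P (R x) ∧ Q (R x) then log 2 else 0) := by
  refine sum_le_sum_of_fib R fun x₀ => ?_
  set A := fib univ R x₀ with hA
  have hAx : ∀ x ∈ A, R x = R x₀ := fun x hx => (mem_fib.1 hx).2
  have e1 : ∀ x ∈ A, (if P (R x) then log #(fib univ R x) - log #(fib univ R' x) else 0) =
      if P (R x₀) then log #A - log #(fib univ R' x) else 0 := fun x hx => by
    rw [hAx x hx, fib_congr (hAx x hx)]
  have e2 : ∀ x ∈ A, (if P (R x) ∧ Q (R x) then log 2 else 0) =
      if P (R x₀) ∧ Q (R x₀) then log 2 else 0 := fun x hx => by rw [hAx x hx]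
  rw [sum_congr rfl e1, sum_congr rfl e2]
  by_cases hP : P (R x₀)
  swap
  · simp [hP]
  simp only [hP, if_true, true_and]
  by_cases hQ : Q (R x₀)
  · simp only [hQ, if_true]
    have hApos : 0 < (#A : ℝ) := card_fib_pos (mem_univ x₀)
    -- This is `log t ≤ t - 1` with `t` the ratio of half the old class size to the new one.
    have k1 : ∀ x ∈ A, log #A - log #(fib univ R' x) ≤
        log 2 + (#A / 2 * (1 / #(fib univ R' x)) - 1) := by
      intro x _
      have hx := card_fib_pos (p := R') (mem_univ x)
      generalize (#(fib univ R' x) : ℝ) = c at hx ⊢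
      generalize (#A : ℝ) = a at hApos ⊢
      have hl := log_le_sub_one_of_pos (x := a / 2 * (1 / c)) (by positivity)
      rw [log_mul (by positivity) (by positivity), log_div (by positivity) (by positivity),
        one_div, log_inv] at hl
      rw [one_div]
      linarith
    -- Summing reciprocal class sizes counts classes, and each of the two values of `b` accounts for
    -- at most one.
    have k2 : ∑ x ∈ A, (1 / #(fib univ R' x) : ℝ) ≤ 2 := by
      rw [← sum_fiberwise A b]
      have : ∀ c : Bool, ∑ x ∈ A with b x = c, (1 / #(fib univ R' x) : ℝ) ≤ 1 := by
        intro c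
        have hle : ∀ x ∈ A.filter (fun x => b x = c),
            (1 / #(fib univ R' x) : ℝ) ≤ 1 / #(A.filter (fun x => b x = c)) := by
          intro x hx
          have hp : 0 < (#(A.filter (fun x => b x = c)) : ℝ) := by
            exact_mod_cast card_pos.2 ⟨x, hx⟩
          refine one_div_le_one_div_of_le hp ?_
          refine mod_cast card_le_card fun x' hx' => ?_
          rw [mem_filter] at hx hx'
          refine mem_fib.2 ⟨mem_univ _, h1 _ _ ?_ ?_ (hx'.2.trans hx.2.symm)⟩
          · rw [hAx _ hx'.1]; exact hQ
          · rw [hAx _ hx'.1, hAx _ hx.1]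
        refine (sum_le_sum hle).trans ?_
        rw [sum_const, nsmul_eq_mul, mul_one_div]
        exact div_self_le_one _
      rw [Fintype.sum_bool]
      linarith [this true, this false]
    refine (sum_le_sum k1).trans ?_
    rw [sum_add_distrib, sum_sub_distrib, ← mul_sum]
    simp only [sum_const, nsmul_eq_mul, mul_one]
    nlinarith
  · simp only [hQ, if_false]
    refine le_of_eq (sum_congr rfl fun x hx => ?_)
    have : fib univ R' x = A := by
      ext x'
      rw [mem_fib, hA, mem_fib]
      simp only [mem_univ, true_and]
      constructor
      · intro h; rw [h3 _ _ h, hAx x hx]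
      · intro h
        exact h2 _ _ (by rw [h]; exact hQ) (by rw [h, hAx x hx])
    rw [this, sub_self]

end Fibers

/-! ### Uniform injective sequences, entry by entry -/

section Sequences

variable {α : Type*} {k : ℕ}

/-- The first `n` entries of `x`. -/
def pre (n : ℕ) (x : Fin k ↪ α) : Fin k → Option α := fun t => if t < n then some (x t) else none

lemma pre_eq_iff {n : ℕ} {x x' : Fin k ↪ α} :
    pre n x = pre n x' ↔ ∀ t : Fin k, (t : ℕ) < n → x t = x' t := by
  rw [funext_iff]
  refine forall_congr' fun t => ?_
  by_cases h : (t : ℕ) < n <;> simp [pre, h]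

lemma pre_eq_of_le {m n : ℕ} (hmn : m ≤ n) {x x' : Fin k ↪ α} (h : pre n x = pre n x') :
    pre m x = pre m x' :=
  pre_eq_iff.2 fun t ht => pre_eq_iff.1 h t (ht.trans_le hmn)

lemma apply_eq_of_pre {i : Fin k} {x x' : Fin k ↪ α} (h : pre (i + 1) x = pre (i + 1) x') :
    x i = x' i :=
  pre_eq_iff.1 h i (Nat.lt_succ_self _)

/-- The chain rule: the sum telescopes from the empty prefix, which says nothing, to the full
prefix, which determines the sequence. -/
lemma sum_infoGain {A B : Finset (Fin k ↪ α)} (hAB : A ⊆ B) {x : Fin k ↪ α} (hx : x ∈ A) :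
    ∑ i : Fin k, infoGain A B (pre i) (pre (i + 1)) x = log #B - log #A := by
  have h0 : ∀ C : Finset (Fin k ↪ α), fib C (pre 0) x = C := by
    intro C
    ext x'
    simp [mem_fib, pre_eq_iff]
  have h1 : ∀ C : Finset (Fin k ↪ α), x ∈ C → fib C (pre k) x = {x} := by
    intro C hC
    ext x'
    rw [mem_fib, pre_eq_iff, mem_singleton]
    constructor
    · rintro ⟨-, h⟩
      exact DFunLike.ext _ _ fun t => h t t.2
    · rintro rfl
      exact ⟨hC, fun _ _ => rfl⟩
  rw [Fin.sum_univ_eq_sum_range (fun n => infoGain A B (pre n) (pre (n + 1)) x) k]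
  simp only [infoGain]
  rw [sum_sub_distrib, sum_range_sub (fun n => log (#(fib A (pre n) x) : ℝ)),
    sum_range_sub (fun n => log (#(fib B (pre n) x) : ℝ)), h0, h0, h1 _ hx, h1 _ (hAB hx)]
  simp only [card_singleton, Nat.cast_one, log_one]
  ring

/-- The number of sequences in `A` which agree with `x` before `i` and have the entry `e` at `i`. -/
noncomputable def next (A : Finset (Fin k ↪ α)) (i : Fin k) (x : Fin k ↪ α) (e : α) : ℕ :=
  #{x' ∈ fib A (pre i) x | x' i = e}

/-- The indicator function of `x i ∈ E`. -/
noncomputable def ind (E : Finset α) (i : Fin k) (x : Fin k ↪ α) : ℝ := if x i ∈ E then 1 else 0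

lemma ind_nonneg (E : Finset α) (i : Fin k) (x : Fin k ↪ α) : 0 ≤ ind E i x := by
  unfold ind; split_ifs <;> norm_num

lemma sum_next_div (A : Finset (Fin k ↪ α)) (i : Fin k) (x : Fin k ↪ α) (E : Finset α) :
    condMean A (pre i) (ind E i) x = (∑ e ∈ E, (next A i x e : ℝ)) / #(fib A (pre i) x) := by
  rw [condMean]
  congr 1
  simp only [ind]
  rw [← sum_filter, sum_const, nsmul_eq_mul, mul_one, ← Nat.cast_sum]
  congr 1
  rw [card_eq_sum_card_fiberwise (f := fun x' => x' i) (t := E)]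
  · refine sum_congr rfl fun e he => ?_
    unfold next
    congr 1
    ext x'
    simp only [mem_filter]
    constructor
    · rintro ⟨⟨h1, -⟩, h2⟩; exact ⟨h1, h2⟩
    · rintro ⟨h1, h2⟩; exact ⟨⟨h1, h2 ▸ he⟩, h2⟩
  · intro x' hx'
    simp only [coe_filter, Set.mem_ofPred_eq] at hx'
    exact hx'.2

lemma next_eq_zero (A : Finset (Fin k ↪ α)) (i : Fin k) (x : Fin k ↪ α) {t : Fin k} (ht : t < i) :
    next A i x (x t) = 0 := by
  rw [next, card_eq_zero, filter_eq_empty_iff]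
  intro x' hx' h
  have := pre_eq_iff.1 (mem_fib.1 hx').2 t ht
  rw [← this] at h
  exact ht.ne' (x'.injective h)

/-- The elements which do not occur in `x` before `i`. -/
noncomputable def unused [Fintype α] (i : Fin k) (x : Fin k ↪ α) : Finset α :=
  univ.filter fun e => ∀ t < i, x t ≠ e

lemma card_unused [Fintype α] (i : Fin k) (x : Fin k ↪ α) :
    #(unused i x)ᶜ ≤ k := by
  have : (unused i x)ᶜ ⊆ univ.map x := by
    intro e he
    simp only [unused, mem_compl, mem_filter, mem_univ, true_and, not_forall] at he
    obtain ⟨t, -, h⟩ := he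
    rw [not_not] at h
    exact mem_map.2 ⟨t, mem_univ _, h⟩
  simpa using card_le_card this

/-- Swapping the values `e'` and `e` preserves a prefix that contains neither; a value already used
cannot occur again. -/
lemma next_le_next [Fintype α] (i : Fin k) (x : Fin k ↪ α) {e : α} (he : e ∈ unused i x) (e' : α) :
    next univ i x e' ≤ next univ i x e := by
  by_cases he' : e' ∈ unused i x
  · simp only [unused, mem_filter, mem_univ, true_and] at he he'
    refine card_le_card_of_injOn (fun x' => x'.trans (Equiv.swap e' e).toEmbedding) ?_ ?_
    · intro x' hx'
      simp only [coe_filter, Set.mem_ofPred_eq, mem_fib, mem_univ, true_and] at hx' ⊢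
      refine ⟨pre_eq_iff.2 fun t ht => ?_, by simp [hx'.2]⟩
      have := pre_eq_iff.1 hx'.1 t ht
      simp only [Function.Embedding.trans_apply, Equiv.coe_toEmbedding, this]
      exact Equiv.swap_apply_of_ne_of_ne (he' t ht) (he t ht)
    · intro x₁ _ x₂ _ h
      refine DFunLike.ext _ _ fun t => ?_
      have := DFunLike.congr_fun h t
      simpa using this
  · simp only [unused, mem_filter, mem_univ, true_and, not_forall] at he'
    obtain ⟨t, ht, h⟩ := he'
    rw [not_not] at h
    rw [← h, next_eq_zero _ _ _ ht]
    exact Nat.zero_le _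

lemma sum_next_univ [Fintype α] (A : Finset (Fin k ↪ α)) (i : Fin k) (x : Fin k ↪ α) :
    ∑ e, next A i x e = #(fib A (pre i) x) :=
  (card_eq_sum_card_fiberwise fun _ _ => mem_coe.2 (mem_univ _)).symm

lemma card_fib_le_mul_next [Fintype α] (i : Fin k) (x : Fin k ↪ α) {e : α}
    (he : e ∈ unused i x) :
    #(fib univ (pre i) x) ≤ Fintype.card α * next univ i x e := by
  rw [← sum_next_univ]
  refine (sum_le_sum fun e' _ => next_le_next i x he e').trans ?_
  simp

/-- At least half of all values are unused, and each of these is at least as frequent as `e`. -/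
lemma mul_next_le [Fintype α] (hk : 2 * k ≤ Fintype.card α) (i : Fin k) (x : Fin k ↪ α) (e : α) :
    Fintype.card α * next univ i x e ≤ 2 * #(fib univ (pre i) x) := by
  have h1 : #(unused i x) * next univ i x e ≤ #(fib univ (pre i) x) := by
    rw [← sum_next_univ, ← smul_eq_mul, ← sum_const]
    exact (sum_le_sum fun e' he' => next_le_next i x he' e).trans
      (sum_le_sum_of_subset (subset_univ _))
  have h2 := card_unused i x
  have h3 := card_add_card_compl (unused i x)
  nlinarith [Nat.zero_le (next univ i x e)]

lemma condMean_ind_le [Fintype α] (hk : 2 * k ≤ Fintype.card α) (i : Fin k) (x : Fin k ↪ α)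
    (E : Finset α) :
    condMean univ (pre i) (ind E i) x ≤ 2 * #E / Fintype.card α := by
  have h0 := card_fib_pos (p := pre (i : ℕ)) (mem_univ x)
  have hU : 0 < (Fintype.card α : ℝ) := by
    have := i.pos; exact_mod_cast (by omega : 0 < Fintype.card α)
  rw [sum_next_div, div_le_div_iff₀ h0 hU, sum_mul]
  calc ∑ e ∈ E, (next univ i x e : ℝ) * Fintype.card α
      ≤ ∑ e ∈ E, (2 * #(fib univ (pre (i : ℕ)) x) : ℝ) := by
        refine sum_le_sum fun e _ => ?_
        rw [mul_comm]
        exact_mod_cast mul_next_le hk i x e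
    _ = _ := by rw [sum_const, nsmul_eq_mul]; ring

lemma le_condMean_ind [Fintype α] (i : Fin k) (x : Fin k ↪ α) (E : Finset α) :
    #(E ∩ unused i x) / Fintype.card α ≤ condMean univ (pre i) (ind E i) x := by
  have h0 := card_fib_pos (p := pre (i : ℕ)) (mem_univ x)
  have hU : 0 < (Fintype.card α : ℝ) := by
    exact_mod_cast Fintype.card_pos_iff.2 ⟨x i⟩
  rw [sum_next_div, div_le_div_iff₀ hU h0, sum_mul]
  calc (#(E ∩ unused i x) : ℝ) * #(fib univ (pre (i : ℕ)) x)
      = ∑ e ∈ E ∩ unused i x, (#(fib univ (pre (i : ℕ)) x) : ℝ) := by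
        rw [sum_const, nsmul_eq_mul]
    _ ≤ ∑ e ∈ E ∩ unused i x, (next univ i x e : ℝ) * Fintype.card α := by
        refine sum_le_sum fun e he => ?_
        rw [mul_comm]
        exact_mod_cast card_fib_le_mul_next i x (mem_inter.1 he).2
    _ ≤ _ := sum_le_sum_of_subset_of_nonneg inter_subset_left fun _ _ _ => by positivity

/-- The Gibbs inequality for the test function `1 + c * 1_E`. -/
lemma sum_test_le {A B : Finset (Fin k ↪ α)} (hAB : A ⊆ B) (i : Fin k)
    {E : (Fin k ↪ α) → Finset α} (hE : ∀ x x', pre i x = pre i x' → E x = E x') {c : ℝ}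
    (hc : -1 ≤ c) (hcA : ∀ x ∈ A, x i ∈ E x → -1 < c) :
    ∑ x ∈ A, (log (1 + c) * ind (E x) i x - c * condMean B (pre i) (ind (E x) i) x) ≤
      ∑ x ∈ A, infoGain A B (pre i) (pre (i + 1)) x := by
  refine le_trans (le_of_eq (sum_congr rfl fun x hx => ?_)) (sum_log_add_one_sub_condMean_le hAB
    (f := fun x => 1 + c * ind (E x) i x) (fun x x' => pre_eq_of_le (Nat.le_succ _)) ?_ ?_ ?_)
  · have h0 := card_fib_pos (p := pre (i : ℕ)) (hAB hx)
    have h1 : condMean B (pre i) (fun x => 1 + c * ind (E x) i x) x =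
        1 + c * condMean B (pre i) (ind (E x) i) x := by
      have : ∀ x' ∈ fib B (pre i) x, 1 + c * ind (E x') i x' = 1 + c * ind (E x) i x' :=
        fun x' hx' => by rw [hE _ _ (mem_fib.1 hx').2]
      rw [condMean, condMean, sum_congr rfl this, sum_add_distrib, ← mul_sum, sum_const,
        nsmul_eq_mul, mul_one]
      field_simp
    have h2 : log (1 + c * ind (E x) i x) = log (1 + c) * ind (E x) i x := by
      unfold ind; split_ifs <;> simp
    rw [h1, h2]
    ring
  · intro x _
    unfold ind; split_ifs <;> linarith
  · intro x hx
    unfold ind; split_ifs with h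
    · linarith [hcA x hx h]
    · norm_num
  · intro x x' h
    simp only [ind, hE _ _ (pre_eq_of_le (Nat.le_succ _) h), apply_eq_of_pre h]

/-- The elements which the `i`-th entry takes with small probability, under the uniform law on
the sequences in `A` with the same entries before `i` as `y`. -/
noncomputable def sparse [Fintype α] (A : Finset (Fin k ↪ α)) (i : Fin k) (y : Fin k ↪ α) :
    Finset α :=
  univ.filter fun e => 4 * Fintype.card α * next A i y e ≤ #(fib A (pre i) y)

lemma next_congr (A : Finset (Fin k ↪ α)) (i : Fin k) {y y' : Fin k ↪ α} (h : pre i y = pre i y')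
    (e : α) : next A i y e = next A i y' e := by
  rw [next, next, fib_congr h]

lemma sparse_congr [Fintype α] (A : Finset (Fin k ↪ α)) (i : Fin k) {y y' : Fin k ↪ α}
    (h : pre i y = pre i y') : sparse A i y = sparse A i y' := by
  simp only [sparse, fib_congr h, next_congr A i h]

/-- The law on `A` gives the sparse set at most a quarter of its probability under the law on all
sequences. Such a deficit costs information in proportion to that probability, which is at least
`(#sparse - k) / U`, because at most `k` values are already used. -/
lemma sum_card_sparse_le [Fintype α] (A : Finset (Fin k ↪ α)) (i : Fin k) :
    ∑ y ∈ A, 3 / 10 * ((#(sparse A i y) - k : ℝ) / Fintype.card α) ≤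
      ∑ y ∈ A, infoGain A univ (pre i) (pre (i + 1)) y := by
  refine le_trans ?_ (sum_test_le (subset_univ A) i (E := sparse A i) (c := -1 / 2)
    (fun y y' => sparse_congr A i) (by norm_num) (fun _ _ _ => by norm_num))
  have h1 : ∑ y ∈ A, ind (sparse A i y) i y =
      ∑ y ∈ A, condMean A (pre i) (ind (sparse A i y) i) y := by
    rw [← sum_condMean_self A (pre i) (fun y => ind (sparse A i y) i y)]
    refine sum_congr rfl fun y _ => ?_
    rw [condMean, condMean]
    congr 1
    exact sum_congr rfl fun y' hy' => by rw [sparse_congr A i (mem_fib.1 hy').2]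
  -- Used values have probability zero. An unused sparse value has probability at most `1 / (4 * U)`
  -- on `A`, and at least `1 / U` on all sequences.
  have h2 : ∀ y ∈ A, condMean A (pre i) (ind (sparse A i y) i) y ≤
      condMean univ (pre i) (ind (sparse A i y) i) y / 4 := by
    intro y hy
    have h0 := card_fib_pos (p := pre (i : ℕ)) hy
    have hU : 0 < (Fintype.card α : ℝ) := by
      exact_mod_cast Fintype.card_pos_iff.2 ⟨y i⟩
    refine le_trans ?_ (div_le_div_of_nonneg_right (le_condMean_ind i y (sparse A i y)) (by norm_num))
    rw [sum_next_div, div_div, div_le_div_iff₀ h0 (by positivity)]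
    have hz : ∑ e ∈ sparse A i y, (next A i y e : ℝ) =
        ∑ e ∈ sparse A i y ∩ unused i y, (next A i y e : ℝ) := by
      refine (sum_subset inter_subset_left fun e he he' => ?_).symm
      have : e ∉ unused i y := fun h => he' (mem_inter.2 ⟨he, h⟩)
      simp only [unused, mem_filter, mem_univ, true_and, not_forall] at this
      obtain ⟨t, ht, h⟩ := this
      rw [not_not] at h
      rw [← h, next_eq_zero _ _ _ ht, Nat.cast_zero]
    rw [hz, sum_mul, ← nsmul_eq_mul #(sparse A i y ∩ unused i y), ← sum_const]
    refine sum_le_sum fun e he => ?_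
    have := (mem_filter.1 (mem_inter.1 he).1).2
    have : (4 * Fintype.card α * next A i y e : ℝ) ≤ #(fib A (pre i) y) := by exact_mod_cast this
    linarith
  have h3 : ∀ y ∈ A, (#(sparse A i y) - k : ℝ) / Fintype.card α ≤
      condMean univ (pre i) (ind (sparse A i y) i) y := by
    intro y _
    refine le_trans ?_ (le_condMean_ind i y (sparse A i y))
    refine div_le_div_of_nonneg_right ?_ (Nat.cast_nonneg _)
    have e1 := card_unused i y
    have e2 : #(sparse A i y) ≤ #(sparse A i y ∩ unused i y) + #(unused i y)ᶜ := by
      rw [← card_inter_add_card_sdiff (sparse A i y) (unused i y)]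
      refine Nat.add_le_add_left (card_le_card fun e he => ?_) _
      exact mem_compl.2 (mem_sdiff.1 he).2
    have : #(sparse A i y) ≤ #(sparse A i y ∩ unused i y) + k := by omega
    have : (#(sparse A i y) : ℝ) ≤ #(sparse A i y ∩ unused i y) + k := by exact_mod_cast this
    linarith
  have h4 : ∀ y ∈ A, 0 ≤ condMean univ (pre i) (ind (sparse A i y) i) y := fun y _ =>
    div_nonneg (sum_nonneg fun _ _ => ind_nonneg _ _ _) (Nat.cast_nonneg _)
  have hlog : log (1 + -1 / 2) = - log 2 := by
    rw [← log_inv]; norm_num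
  have e3 := sum_le_sum h3
  have e2 := sum_le_sum h2
  have e4 := sum_nonneg h4
  rw [hlog, sum_sub_distrib, ← mul_sum, ← mul_sum, ← mul_sum, h1]
  rw [← sum_div] at e2
  -- The remaining coefficient is `1/2 - log 2 / 4`, which exceeds `3/10`.
  nlinarith [log_two_lt_d9, log_two_gt_d9]

lemma card_sdiff_sparse_le [Fintype α] {A : Finset (Fin k ↪ α)} (i : Fin k) {y : Fin k ↪ α}
    (hy : y ∈ A) (E : Finset α) :
    (#(E \ sparse A i y) : ℝ) / (4 * Fintype.card α) ≤ condMean A (pre i) (ind E i) y := by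
  have h0 := card_fib_pos (p := pre (i : ℕ)) hy
  have hU : 0 < (Fintype.card α : ℝ) := by
    exact_mod_cast Fintype.card_pos_iff.2 ⟨y i⟩
  rw [sum_next_div, div_le_div_iff₀ (by positivity) h0]
  refine le_trans ?_ (mul_le_mul_of_nonneg_right (sum_le_sum_of_subset_of_nonneg
    (sdiff_subset (s := E) (t := sparse A i y)) fun _ _ _ => Nat.cast_nonneg _) (by positivity))
  rw [sum_mul, ← nsmul_eq_mul, ← sum_const]
  refine sum_le_sum fun e he => ?_
  have := (mem_sdiff.1 he).2
  simp only [sparse, mem_filter, mem_univ, true_and, not_le] at this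
  have : (#(fib A (pre i) y) : ℝ) < 4 * Fintype.card α * next A i y e := by exact_mod_cast this
  linarith

end Sequences

/-! ### Rectangular partitions on two levels -/

/-- The fibres of `u` are rectangles. -/
def IsRect {X Y V : Type*} (u : X → Y → V) : Prop :=
  ∀ x y x' y', u x y = u x' y' → u x y' = u x y

namespace IsRect

variable {X Y V : Type*} {u : X → Y → V}

lemma flip (hu : IsRect u) : IsRect fun y x => u x y := fun y x y' x' h =>
  (hu x' y' x y h.symm).trans h.symm

/-- Bob's side of a rectangle is the same for each of Alice's inputs in it, so that sets defined
from it are fixed test sets on Alice's side. -/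
lemma fib_eq [Fintype Y] (hu : IsRect u) {x y x' y'} (h : u x y = u x' y') :
    fib univ (u x) y = fib univ (u x') y' := by
  ext y''
  simp only [mem_fib, mem_univ, true_and]
  constructor
  · intro h'
    exact hu x' y' x y'' (h'.trans h).symm
  · intro h'
    exact hu x y x' y'' (h.trans h'.symm)

end IsRect

lemma sum_sum_sum_infoGain {α X Y : Type*} [Fintype X] [Fintype Y] {n : ℕ}
    {A B : X → Y → Finset (Fin n ↪ α)} {z : X → Y → Fin n ↪ α} (hAB : ∀ x y, A x y ⊆ B x y)
    (hz : ∀ x y, z x y ∈ A x y) :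
    ∑ i : Fin n, ∑ x, ∑ y, infoGain (A x y) (B x y) (pre i) (pre (i + 1)) (z x y) =
      ∑ x, ∑ y, (log #(B x y) - log #(A x y)) := by
  rw [sum_comm]
  refine sum_congr rfl fun x _ => ?_
  rw [sum_comm]
  exact sum_congr rfl fun y _ => sum_infoGain (hAB x y) (hz x y)

section TwoLevels

variable {α V W : Type*} [Fintype α] {k l : ℕ}
  {u : (Fin k ↪ α) → (Fin l ↪ α) → V} {w : (Fin k ↪ α) → (Fin l ↪ α) → W}

/-- The elements of `x`, as a set. -/
def entries {n : ℕ} (x : Fin n ↪ α) : Finset α := univ.map x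

/-- The values, apart from those in `Z`, of the `j`-th entry of the sequences in `A` which agree
with `x` before `j`. -/
noncomputable def options (A : Finset (Fin k ↪ α)) (Z : Finset α) (j : Fin k) (x : Fin k ↪ α) :
    Finset α :=
  ((fib A (pre j) x).image fun x' => x' j) \ Z

/-- `sparse` for Bob's side of the class of `u` at `(x, y)`. -/
noncomputable def sparseAt (u : (Fin k ↪ α) → (Fin l ↪ α) → V) (i : Fin l) (x : Fin k ↪ α)
    (y : Fin l ↪ α) : Finset α :=
  sparse (fib univ (u x) y) i y

/-- `options` for Alice's side of the class of `w` at `(x, y)`. -/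
noncomputable def optionsAt (w : (Fin k ↪ α) → (Fin l ↪ α) → W) (j : Fin k) (x : Fin k ↪ α)
    (y : Fin l ↪ α) : Finset α :=
  options (fib univ (fun x' => w x' y) x) (entries x ∩ entries y) j x

lemma sum_sparseAt_le (i : Fin l) (x : Fin k ↪ α) :
    ∑ y, 3 / 10 * ((#(sparseAt u i x y) - l : ℝ) / Fintype.card α) ≤
      ∑ y, infoGain (fib univ (u x) y) univ (pre i) (pre (i + 1)) y := by
  refine sum_le_sum_of_fib (u x) fun y₀ => ?_
  refine le_trans (le_of_eq (sum_congr rfl fun y hy => ?_))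
    ((sum_card_sparse_le (fib univ (u x) y₀) i).trans
      (le_of_eq (sum_congr rfl fun y hy => ?_)))
  · rw [sparseAt, fib_congr (mem_fib.1 hy).2]
  · rw [fib_congr (mem_fib.1 hy).2]

/-- Within a class of `u` the sparse set does not depend on `x`, so the test with `c = 1` applies:
`x j` can fall in a small set often only if phase one reveals information about it. -/
lemma sum_ind_sparseAt_le (hk : 2 * k ≤ Fintype.card α) (hu : IsRect u) (i : Fin l) (j : Fin k)
    (y : Fin l ↪ α) :
    ∑ x, (log 2 * ind (sparseAt u i x y) j x - 2 * #(sparseAt u i x y) / Fintype.card α) ≤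
      ∑ x, infoGain (fib univ (fun x' => u x' y) x) univ (pre j) (pre (j + 1)) x := by
  refine sum_le_sum_of_fib (fun x => u x y) fun x₀ => ?_
  refine le_trans (sum_le_sum fun x hx => ?_)
    ((sum_test_le (c := 1) (E := fun _ => sparseAt u i x₀ y) (subset_univ _) j
      (fun _ _ _ => rfl) (by norm_num) (fun _ _ _ => by norm_num)).trans
      (le_of_eq (sum_congr rfl fun x hx => ?_)))
  · have : sparseAt u i x y = sparseAt u i x₀ y := by
      rw [sparseAt, sparseAt, hu.fib_eq (mem_fib.1 hx).2]
    rw [this, one_mul, one_add_one_eq_two]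
    linarith [condMean_ind_le hk j x (sparseAt u i x₀ y)]
  · rw [fib_congr (p := fun x => u x y) (mem_fib.1 hx).2]

/-- Within a class of `w` the test set depends only on the entries of `x` before `j`. Each hit is
worth `log (1 + M)`, at a price of `M` times the probability of the set under the uniform law. -/
lemma sum_ind_optionsAt_le (hk : 2 * k ≤ Fintype.card α) (hu : IsRect u)
    (hwu : ∀ x y x' y', w x y = w x' y' → u x y = u x' y')
    (hZ : ∀ x y x' y', w x y = w x' y' → entries x ∩ entries y = entries x' ∩ entries y')
    {M : ℝ} (hM : 0 ≤ M) (i : Fin l) (j : Fin k) (y : Fin l ↪ α) :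
    ∑ x, (log (1 + M) * ind (optionsAt w j x y \ sparseAt u i x y) j x -
        M * (2 * #(optionsAt w j x y \ sparseAt u i x y) / Fintype.card α)) ≤
      ∑ x, infoGain (fib univ (fun x' => w x' y) x) univ (pre j) (pre (j + 1)) x := by
  refine sum_le_sum_of_fib (fun x => w x y) fun x₀ => ?_
  set E : (Fin k ↪ α) → Finset α := fun x =>
    options (fib univ (fun x' => w x' y) x₀) (entries x₀ ∩ entries y) j x \ sparseAt u i x₀ y
  refine le_trans (sum_le_sum fun x hx => ?_)
    ((sum_test_le (c := M) (E := E) (subset_univ _) j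
      (fun x x' h => ?_) (by linarith) (fun _ _ _ => by linarith)).trans
      (le_of_eq (sum_congr rfl fun x hx => ?_)))
  · have hxw := (mem_fib.1 hx).2
    have h1 : sparseAt u i x y = sparseAt u i x₀ y := by
      rw [sparseAt, sparseAt, hu.fib_eq (hwu _ _ _ _ hxw)]
    have h2 : optionsAt w j x y \ sparseAt u i x y = E x := by
      simp only [E]
      rw [h1, optionsAt, fib_congr (p := fun x => w x y) hxw, hZ _ _ _ _ hxw]
    rw [h2]
    linarith [mul_le_mul_of_nonneg_left (condMean_ind_le hk j x (E x)) hM]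
  · simp only [E, options]
    rw [fib_congr h]
  · rw [fib_congr (p := fun x => w x y) (mem_fib.1 hx).2]

/-- At the end `y i` avoids every option for `x j`, so all the probability that phase one left on
the options has been removed. An option that is not sparse had probability more than `1 / (4 * U)`.
-/
lemma sum_optionsAt_sdiff_le (hw : IsRect w)
    (hwu : ∀ x y x' y', w x y = w x' y' → u x y = u x' y')
    (hZ : ∀ x y x' y', w x y = w x' y' → entries x ∩ entries y = entries x' ∩ entries y')
    (i : Fin l) (j : Fin k) (x : Fin k ↪ α) :
    ∑ y, (#(optionsAt w j x y \ sparseAt u i x y) : ℝ) / (4 * Fintype.card α) ≤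
      ∑ y, infoGain (fib univ (w x) y) (fib univ (u x) y) (pre i) (pre (i + 1)) y := by
  refine sum_le_sum_of_fib (w x) fun y₀ => ?_
  have hsub : fib univ (w x) y₀ ⊆ fib univ (u x) y₀ := fun y hy =>
    mem_fib.2 ⟨mem_univ _, hwu _ _ _ _ (mem_fib.1 hy).2⟩
  refine le_trans (sum_le_sum fun y hy => ?_)
    -- With `c = -1` the test function is the indicator of the complement of the options. It need
    -- only be positive on the finer class, and there `y i` is never an option. The logarithmic term
    -- vanishes since `log 0 = 0`.
    ((sum_test_le (c := -1) (E := fun _ => optionsAt w j x y₀) hsub i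
      (fun _ _ _ => rfl) le_rfl (fun y hy h => ?_)).trans
      (le_of_eq (sum_congr rfl fun y hy => ?_)))
  · have hyw := (mem_fib.1 hy).2
    have h1 : sparseAt u i x y = sparse (fib univ (u x) y₀) i y := by
      rw [sparseAt, fib_congr (hwu _ _ _ _ hyw)]
    have h2 : optionsAt w j x y = optionsAt w j x y₀ := by
      rw [optionsAt, optionsAt, hw.flip.fib_eq hyw, hZ _ _ _ _ hyw]
    rw [h1, h2]
    have := card_sdiff_sparse_le i (hsub hy) (optionsAt w j x y₀)
    norm_num
    exact this
  · exfalso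
    -- If `y i = x' j` for some `x'` in Alice's class, then `(x', y)` is in the same rectangle, so
    -- `y i` belongs to the common intersection, which the options exclude.
    rw [optionsAt, options, mem_sdiff, mem_image] at h
    obtain ⟨⟨x', hx', h1⟩, h2⟩ := h
    have hx'w : w x' y₀ = w x y₀ := (mem_fib.1 (mem_fib.1 hx').1).2
    have hyw := (mem_fib.1 hy).2
    have h3 : w x' y = w x y₀ := (hw x' y₀ x y (hx'w.trans hyw.symm)).trans hx'w
    rw [← hZ _ _ _ _ h3, ← h1] at h2
    refine h2 (mem_inter.2 ⟨mem_map.2 ⟨j, mem_univ _, rfl⟩, mem_map.2 ⟨i, mem_univ _, h1.symm⟩⟩)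
  · have hyw := (mem_fib.1 hy).2
    rw [fib_congr hyw, fib_congr (hwu _ _ _ _ hyw)]

lemma sum_ind_entries_le (hk : 2 * k ≤ Fintype.card α) (j : Fin k) (y : Fin l ↪ α) :
    ∑ x, ind (entries y) j x ≤ ∑ _x : Fin k ↪ α, (2 * l / Fintype.card α : ℝ) := by
  rw [← sum_condMean_self univ (pre j)]
  refine sum_le_sum fun x _ => (condMean_ind_le hk j x _).trans (le_of_eq ?_)
  simp [entries]

lemma one_le_ind_add (i : Fin l) (j : Fin k) (x : Fin k ↪ α) (y : Fin l ↪ α) :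
    1 ≤ ind (optionsAt w j x y \ sparseAt u i x y) j x + ind (sparseAt u i x y) j x +
      ind (entries y) j x := by
  by_cases h1 : x j ∈ entries y
  · have : ind (entries y) j x = 1 := by simp [ind, h1]
    linarith [ind_nonneg (sparseAt u i x y) j x,
      ind_nonneg (optionsAt w j x y \ sparseAt u i x y) j x]
  by_cases h2 : x j ∈ sparseAt u i x y
  · have : ind (sparseAt u i x y) j x = 1 := by simp [ind, h2]
    linarith [ind_nonneg (entries y) j x,
      ind_nonneg (optionsAt w j x y \ sparseAt u i x y) j x]
  · have : ind (optionsAt w j x y \ sparseAt u i x y) j x = 1 := by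
      rw [ind, if_pos]
      refine mem_sdiff.2 ⟨mem_sdiff.2 ⟨mem_image.2 ⟨x, self_mem_fib (self_mem_fib (mem_univ x)),
        rfl⟩, fun h => h1 (mem_inter.1 h).2⟩, h2⟩
    linarith [ind_nonneg (entries y) j x, ind_nonneg (sparseAt u i x y) j x]

/-- Unless `x j` is sparse or in `y`, it is a non-sparse option. So options are hit often, which
costs Alice information unless they are many, and then it costs Bob. -/
lemma coordinate_bound (hk : 2 * k ≤ Fintype.card α) (hu : IsRect u) (hw : IsRect w)
    (hwu : ∀ x y x' y', w x y = w x' y' → u x y = u x' y')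
    (hZ : ∀ x y x' y', w x y = w x' y' → entries x ∩ entries y = entries x' ∩ entries y')
    {M : ℝ} (hM : 0 ≤ M) (i : Fin l) (j : Fin k) :
    log (1 + M) * (∑ _x : Fin k ↪ α, ∑ _y : Fin l ↪ α, (1 - 6 * l / Fintype.card α : ℝ) -
        2 * ∑ x, ∑ y, infoGain (fib univ (fun x' => u x' y) x) univ (pre j) (pre (j + 1)) x -
        40 / 3 * ∑ x, ∑ y, infoGain (fib univ (u x) y) univ (pre i) (pre (i + 1)) y) ≤
      ∑ x, ∑ y, infoGain (fib univ (fun x' => w x' y) x) univ (pre j) (pre (j + 1)) x +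
        8 * M * ∑ x, ∑ y,
          infoGain (fib univ (w x) y) (fib univ (u x) y) (pre i) (pre (i + 1)) y := by
  have hU : 0 < (Fintype.card α : ℝ) := by
    have := j.pos; exact_mod_cast (by omega : 0 < Fintype.card α)
  have b1 := sum_le_sum fun x (_ : x ∈ univ) => sum_sparseAt_le (u := u) i x
  have b2 := sum_le_sum fun y (_ : y ∈ univ) => sum_ind_sparseAt_le hk hu i j y
  have b3 := sum_le_sum fun y (_ : y ∈ univ) => sum_ind_optionsAt_le hk hu hwu hZ hM i j y
  have b4 := sum_le_sum fun x (_ : x ∈ univ) => sum_optionsAt_sdiff_le hw hwu hZ i j x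
  have b5 := sum_le_sum fun y (_ : y ∈ univ) => sum_ind_entries_le hk j (y : Fin l ↪ α)
  have b6 := sum_le_sum fun x (_ : x ∈ univ) => sum_le_sum fun y (_ : y ∈ univ) =>
    one_le_ind_add (u := u) (w := w) i j x y
  have b7 : 0 ≤ ∑ x, ∑ y, ind (sparseAt u i x y) j x :=
    sum_nonneg fun x _ => sum_nonneg fun y _ => ind_nonneg _ _ _
  have b2' := (sum_comm.trans_le b2).trans_eq sum_comm
  have b3' := (sum_comm.trans_le b3).trans_eq sum_comm
  have b5' := (sum_comm.trans_le b5).trans_eq sum_comm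
  clear b2 b3 b5
  simp only [sum_sub_distrib, sum_add_distrib, ← mul_sum, ← sum_div, sum_const, nsmul_eq_mul]
    at b1 b2' b3' b4 b5' b6 b7 ⊢
  generalize (∑ x, ∑ y, infoGain (fib univ (fun x' => u x' y) x) univ (pre j) (pre (j + 1)) x) = K1
    at *
  generalize (∑ x, ∑ y, infoGain (fib univ (u x) y) univ (pre i) (pre (i + 1)) y) = L1 at *
  generalize (∑ x, ∑ y, infoGain (fib univ (fun x' => w x' y) x) univ (pre j) (pre (j + 1)) x) = K2
    at *
  generalize (∑ x, ∑ y,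
    infoGain (fib univ (w x) y) (fib univ (u x) y) (pre i) (pre (i + 1)) y) = L2 at *
  generalize (∑ x, ∑ y, ind (sparseAt u i x y) j x) = PS at *
  generalize (∑ x, ∑ y, ind (optionsAt w j x y \ sparseAt u i x y) j x) = PD at *
  generalize (∑ x : Fin k ↪ α, ∑ y, ind (entries (y : Fin l ↪ α)) j x) = PY at *
  generalize (∑ x, ∑ y, (#(sparseAt u i x y) : ℝ)) = CS at *
  generalize (∑ x, ∑ y, (#(optionsAt w j x y \ sparseAt u i x y) : ℝ)) = CD at *
  generalize (#(univ : Finset (Fin k ↪ α)) : ℝ) = n at *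
  generalize (#(univ : Finset (Fin l ↪ α)) : ℝ) = m at *
  generalize (Fintype.card α : ℝ) = U at *
  have hlog : 0 ≤ log (1 + M) := log_nonneg (by linarith)
  have c1 : CS / U ≤ 10 / 3 * L1 + m * (n * l) / U := by
    -- `K1`, `L1` are the information of Alice and Bob at `u`; `K2` is Alice's at `w`, and `L2` is
    -- Bob's at `w` beyond `u`.
    rw [sub_div] at b1; linarith
  have c2 : PS ≤ 2 * K1 + 4 * (CS / U) := by
    rw [mul_div_assoc] at b2'
    nlinarith [log_two_gt_d9]
  -- The loss `6 * l / U` is `2 * l / U` for entries of `y` plus `4 * l / U` from the bound on the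
  -- size of the sparse set.
  have c3 : m * (n * 1) - 6 * (m * (n * l)) / U - 2 * K1 - 40 / 3 * L1 ≤ PD := by
    rw [mul_div_assoc] at b5' ⊢
    linarith
  have c4 : CD / U ≤ 4 * L2 := by
    rw [mul_comm (4 : ℝ), ← div_div] at b4; linarith
  have c5 := mul_le_mul_of_nonneg_left c3 hlog
  have c6 := mul_le_mul_of_nonneg_left c4 hM
  have c7 : M * (2 * CD / U) = 2 * (M * (CD / U)) := by ring
  linarith

/-- A two-level rectangular partition of the pairs of sequences, on whose finer classes the
intersection is constant, cannot reveal little on both levels. -/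
lemma partition_bound (hk : 2 * k ≤ Fintype.card α) (hu : IsRect u) (hw : IsRect w)
    (hwu : ∀ x y x' y', w x y = w x' y' → u x y = u x' y')
    (hZ : ∀ x y x' y', w x y = w x' y' → entries x ∩ entries y = entries x' ∩ entries y')
    {M : ℝ} (hM : 0 ≤ M) :
    log (1 + M) * (k * l * ∑ _x : Fin k ↪ α, ∑ _y : Fin l ↪ α, (1 - 6 * l / Fintype.card α : ℝ) -
        2 * l * ∑ x, ∑ y, (log #(univ : Finset (Fin k ↪ α)) -
          log #(fib univ (fun x' => u x' y) x)) -
        40 / 3 * k * ∑ x, ∑ y, (log #(univ : Finset (Fin l ↪ α)) - log #(fib univ (u x) y))) ≤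
      l * ∑ x, ∑ y, (log #(univ : Finset (Fin k ↪ α)) - log #(fib univ (fun x' => w x' y) x)) +
        8 * M * k * ∑ x, ∑ y, (log #(fib univ (u x) y) - log #(fib univ (w x) y)) := by
  have h := sum_le_sum fun i (_ : i ∈ (univ : Finset (Fin l))) =>
    sum_le_sum fun j (_ : j ∈ (univ : Finset (Fin k))) => coordinate_bound hk hu hw hwu hZ hM i j
  simp only [sum_add_distrib, ← mul_sum, sum_sub_distrib, sum_const, nsmul_eq_mul, card_univ,
    Fintype.card_fin] at h
  have e1 := sum_sum_sum_infoGain (A := fun x y => fib univ (fun x' => u x' y) x)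
    (B := fun _ _ => univ) (z := fun x _ => x) (fun _ _ => subset_univ _)
    (fun x y => self_mem_fib (mem_univ x))
  have e2 := sum_sum_sum_infoGain (A := fun x y => fib univ (fun x' => w x' y) x)
    (B := fun _ _ => univ) (z := fun x _ => x) (fun _ _ => subset_univ _)
    (fun x y => self_mem_fib (mem_univ x))
  have e3 := sum_sum_sum_infoGain (A := fun x y => fib univ (u x) y)
    (B := fun _ _ => univ) (z := fun _ y => y) (fun _ _ => subset_univ _)
    (fun x y => self_mem_fib (mem_univ y))
  have e4 := sum_sum_sum_infoGain (A := fun x y => fib univ (w x) y)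
    (B := fun x y => fib univ (u x) y) (z := fun _ y => y)
    (fun x y y' hy' => mem_fib.2 ⟨mem_univ _, hwu _ _ _ _ (mem_fib.1 hy').2⟩)
    (fun x y => self_mem_fib (mem_univ y))
  rw [e1, e2, e3, e4] at h
  simp only [sum_sub_distrib, sum_const, nsmul_eq_mul, card_univ] at h ⊢
  linarith

end TwoLevels

/-! ### Transcripts: rectangles and information per bit -/

section Runs

variable {X Y γ : Type*} (T : ProtocolTree X Y γ)

lemma run_succ (x : X) (y : Y) (n : ℕ) : T.run x y (n + 1) = T.step x y (T.run x y n) :=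
  Function.iterate_succ_apply' _ _ _

/-- Until a leaf is reached the transcript has exactly one bit per round, so a longer transcript
determines every earlier one by truncation. -/
lemma node_eq_none_or_length (x : X) (y : Y) (n : ℕ) :
    (T.run x y n).length ≤ n ∧ (T.node (T.run x y n) = none ∨ (T.run x y n).length = n) := by
  induction n with
  | zero => simp [ProtocolTree.run]
  | succ n ih =>
    rw [run_succ]
    rcases h : T.node (T.run x y n) with _ | _ | _
    · simp only [ProtocolTree.step, h]
      exact ⟨ih.1.trans (Nat.le_succ n), Or.inl trivial⟩
    all_goals
      have h' := ih.2.resolve_left (by simp [h])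
      simp [ProtocolTree.step, h, h']

lemma run_eq_take (x : X) (y : Y) (n : ℕ) : T.run x y n = (T.run x y (n + 1)).take n := by
  have h1 := node_eq_none_or_length T x y n
  rw [run_succ]
  rcases h : T.node (T.run x y n) with _ | _ | _
  · simp [ProtocolTree.step, h, List.take_of_length_le h1.1]
  all_goals
    have h' := h1.2.resolve_left (by simp [h])
    simp only [ProtocolTree.step, h]
    rw [List.take_left' h']

lemma run_prefix_run {x : X} {y : Y} {m n : ℕ} (h : m ≤ n) : T.run x y m <+: T.run x y n := by
  induction n, h using Nat.le_induction with
  | base => exact List.prefix_refl _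
  | succ n _ ih =>
    refine ih.trans ?_
    rw [run_eq_take T x y n]
    exact List.take_prefix _ _

lemma run_eq_of_le {x x' : X} {y y' : Y} {m n : ℕ} (hmn : m ≤ n)
    (h : T.run x y n = T.run x' y' n) : T.run x y m = T.run x' y' m := by
  induction n, hmn using Nat.le_induction with
  | base => exact h
  | succ n _ ih => exact ih (by rw [run_eq_take T x y, run_eq_take T x' y', h])

/-- By induction the inputs share a transcript up to the last round. The next bit depends either on
`x`, common to `(x, y)` and `(x, y')`, or on `y'`, common to `(x, y')` and `(x', y')`. -/
lemma isRect_run (n : ℕ) : IsRect fun x y => T.run x y n := by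
  induction n with
  | zero => intro x y x' y' _; rfl
  | succ n ih =>
    intro x y x' y' h
    have h1 := run_eq_of_le T (Nat.le_succ n) h
    have h2 : T.run x y' n = T.run x y n := ih _ _ _ _ h1
    simp only [run_succ] at h ⊢
    rw [h2]
    rw [← h1] at h
    rcases hv : T.node (T.run x y n) with _ | _ | _
    · simp [ProtocolTree.step, hv]
    · simp [ProtocolTree.step, hv]
    · rw [h]
      simp [ProtocolTree.step, hv]

lemma run_eq_of_node_eq_none {x : X} {y : Y} {m n : ℕ} (hmn : m ≤ n)
    (h : T.node (T.run x y m) = none) : T.run x y n = T.run x y m := by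
  induction n, hmn using Nat.le_induction with
  | base => rfl
  | succ n _ ih => rw [run_succ, ih, ProtocolTree.step, h]

/-- The mixed input `(x, y')` has the same transcript: Alice cannot tell it from `(x, y)`, nor Bob
from `(x', y')`, and on it both players give the same answer. -/
lemma outputs_inter_eq {δ : Type*} {f : X → Y → δ} {T : ProtocolTree X Y δ}
    {N : ℕ} (hN : ∀ x y, T.outA (T.run x y N) x = f x y ∧ T.outB (T.run x y N) y = f x y)
    {x x' : X} {y y' : Y} (h : T.run x y N = T.run x' y' N) : f x y = f x' y' := by
  have h1 : T.run x y' N = T.run x y N := isRect_run T N _ _ _ _ h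
  rw [← (hN x y).1, ← h1, (hN x y').1, ← (hN x y').2, h1, h, (hN x' y').2]

/-- The number of bits which player `p` sends at nodes satisfying `P` in the first `N` rounds. -/
noncomputable def count (P : List Bool → Prop) (p : Player) (N : ℕ) (x : X) (y : Y) : ℕ :=
  #{n ∈ range N | P (T.run x y n) ∧ T.node (T.run x y n) = some p}

/-- The information revealed at nodes satisfying `P` is at most the number of bits sent there. -/
lemma sum_log_le_count_aux {Ω V : Type*} [Fintype Ω] (R : ℕ → Ω → V) (b : ℕ → Ω → Bool)
    (P Q : V → Prop) (h1 : ∀ n x x', Q (R n x) → R n x = R n x' → b n x = b n x' →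
      R (n + 1) x = R (n + 1) x')
    (h2 : ∀ n x x', ¬ Q (R n x) → R n x = R n x' → R (n + 1) x = R (n + 1) x')
    (h3 : ∀ n x x', R (n + 1) x = R (n + 1) x' → R n x = R n x') (N : ℕ) :
    ∑ x, ∑ n ∈ range N, (if P (R n x) then
        log #(fib univ (R n) x) - log #(fib univ (R (n + 1)) x) else 0) ≤
      log 2 * ∑ x, (#{n ∈ range N | P (R n x) ∧ Q (R n x)} : ℝ) := by
  rw [sum_comm, mul_sum]
  have : ∀ x, log 2 * (#{n ∈ range N | P (R n x) ∧ Q (R n x)} : ℝ) =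
      ∑ n ∈ range N, if P (R n x) ∧ Q (R n x) then log 2 else 0 := by
    intro x
    rw [← sum_filter, sum_const, nsmul_eq_mul, mul_comm]
  rw [sum_congr rfl fun x _ => this x, sum_comm (s := univ)]
  exact sum_le_sum fun n _ => sum_log_card_fib_sub_le (R n) (R (n + 1)) (b n) P Q (h1 n) (h2 n)
    (h3 n)

lemma sum_log_le_count_alice [Fintype X] (P : List Bool → Prop) (N : ℕ) (y : Y) :
    ∑ x, ∑ n ∈ range N, (if P (T.run x y n) then
        log #(fib univ (fun x => T.run x y n) x) -
          log #(fib univ (fun x => T.run x y (n + 1)) x) else 0) ≤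
      log 2 * ∑ x, (count T P Player.alice N x y : ℝ) := by
  refine sum_log_le_count_aux (fun n x => T.run x y n) (fun n x => T.bitA (T.run x y n) x)
    P (fun v => T.node v = some Player.alice) ?_ ?_ ?_ N
    |>.trans (le_of_eq (by unfold count; congr!))
  · intro n x x' hQ h hb
    rw [run_succ, run_succ, ← h]
    rw [← h] at hb
    simp [ProtocolTree.step, hQ, hb]
  · intro n x x' hQ h
    rw [run_succ, run_succ, ← h]
    rcases hv : T.node (T.run x y n) with _ | _ | _
    · simp [ProtocolTree.step, hv]
    · exact absurd hv hQ
    · simp [ProtocolTree.step, hv]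
  · exact fun n x x' => run_eq_of_le T (Nat.le_succ n)

lemma sum_log_le_count_bob [Fintype Y] (P : List Bool → Prop) (N : ℕ) (x : X) :
    ∑ y, ∑ n ∈ range N, (if P (T.run x y n) then
        log #(fib univ (fun y => T.run x y n) y) -
          log #(fib univ (fun y => T.run x y (n + 1)) y) else 0) ≤
      log 2 * ∑ y, (count T P Player.bob N x y : ℝ) := by
  refine sum_log_le_count_aux (fun n y => T.run x y n) (fun n y => T.bitB (T.run x y n) y)
    P (fun v => T.node v = some Player.bob) ?_ ?_ ?_ N
    |>.trans (le_of_eq (by unfold count; congr!))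
  · intro n y y' hQ h hb
    rw [run_succ, run_succ, ← h]
    rw [← h] at hb
    simp [ProtocolTree.step, hQ, hb]
  · intro n y y' hQ h
    rw [run_succ, run_succ, ← h]
    rcases hv : T.node (T.run x y n) with _ | _ | _
    · simp [ProtocolTree.step, hv]
    · simp [ProtocolTree.step, hv]
    · exact absurd hv hQ
  · exact fun n y y' => run_eq_of_le T (Nat.le_succ n)

end Runs

/-! ### Splitting the information at the phase transition -/

section Phases

variable {X Y γ : Type*} (T : TwoPhaseTree X Y γ)

/-- The round at which phase two begins, or `N` if this round is later. -/
noncomputable def transition (N : ℕ) (x : X) (y : Y) : ℕ :=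
  Nat.find (p := fun n => T.phase (T.run x y n) = Phase.two ∨ N ≤ n) ⟨N, Or.inr le_rfl⟩

/-- The round at which phase two begins, and the transcript of phase one. -/
noncomputable def phaseOne (N : ℕ) (x : X) (y : Y) : ℕ × List Bool :=
  (transition T N x y, T.run x y (transition T N x y))

lemma phase_mono {v v' : List Bool} (h : v <+: v') (hv : T.phase v = Phase.two) :
    T.phase v' = Phase.two := by
  unfold TwoPhaseTree.phase at *
  split_ifs at hv with h1
  obtain ⟨m, h1, h2⟩ := h1
  rw [if_pos ⟨m, h1.trans h, h2⟩]

lemma transition_le (N : ℕ) (x : X) (y : Y) : transition T N x y ≤ N :=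
  Nat.find_min' _ (Or.inr le_rfl)

lemma phase_eq_two_iff {N : ℕ} {x : X} {y : Y} {n : ℕ} (hn : n < N) :
    T.phase (T.run x y n) = Phase.two ↔ transition T N x y ≤ n := by
  constructor
  · exact fun h => Nat.find_min' _ (Or.inl h)
  · intro h
    have hs := Nat.find_spec (p := fun n => T.phase (T.run x y n) = Phase.two ∨ N ≤ n)
      ⟨N, Or.inr le_rfl⟩
    change _ ∨ N ≤ transition T N x y at hs
    exact phase_mono T (run_prefix_run _ h) (hs.resolve_right (by omega))

lemma phase_eq_one_iff {N : ℕ} {x : X} {y : Y} {n : ℕ} (hn : n < N) :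
    T.phase (T.run x y n) = Phase.one ↔ n < transition T N x y := by
  rw [← not_le, ← phase_eq_two_iff T hn]
  cases T.phase (T.run x y n) <;> simp

/-- The transition is a stopping time: the transcript up to that round decides whether it has
occurred. -/
lemma transition_congr {N : ℕ} {x x' : X} {y y' : Y}
    (h : T.run x y (transition T N x y) = T.run x' y' (transition T N x y)) :
    transition T N x' y' = transition T N x y := by
  have hle : ∀ n ≤ transition T N x y, T.run x' y' n = T.run x y n := fun n hn =>
    (run_eq_of_le _ hn h).symm
  refine (Nat.find_eq_iff _).2 ⟨?_, fun n hn => ?_⟩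
  · rw [hle _ le_rfl]
    exact Nat.find_spec (p := fun n => T.phase (T.run x y n) = Phase.two ∨ N ≤ n)
      ⟨N, Or.inr le_rfl⟩
  · rw [hle _ hn.le]
    exact Nat.find_min (p := fun n => T.phase (T.run x y n) = Phase.two ∨ N ≤ n) _ hn

lemma phaseOne_eq_iff {N : ℕ} {x x' : X} {y y' : Y} :
    phaseOne T N x' y' = phaseOne T N x y ↔
      T.run x' y' (transition T N x y) = T.run x y (transition T N x y) := by
  constructor
  · intro h
    have h1 := congrArg Prod.fst h
    have h2 := congrArg Prod.snd h
    simp only [phaseOne] at h1 h2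
    rw [h1] at h2
    exact h2
  · intro h
    have := transition_congr T h.symm
    simp only [phaseOne, this, h]

lemma isRect_phaseOne (N : ℕ) : IsRect (phaseOne T N) := by
  intro x y x' y' h
  rw [phaseOne_eq_iff]
  exact isRect_run _ _ _ _ _ _ ((phaseOne_eq_iff T).1 h.symm).symm

lemma phaseOne_eq_of_run {N : ℕ} {x x' : X} {y y' : Y} (h : T.run x y N = T.run x' y' N) :
    phaseOne T N x y = phaseOne T N x' y' :=
  ((phaseOne_eq_iff T).2 (run_eq_of_le _ (transition_le T N x y) h).symm).symm

lemma sum_range_ite_lt (f : ℕ → ℝ) {m N : ℕ} (h : m ≤ N) :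
    ∑ n ∈ range N, (if n < m then f n - f (n + 1) else 0) = f 0 - f m := by
  rw [← sum_range_sub', ← sum_filter]
  congr 1
  ext n
  simp only [mem_filter, mem_range]
  omega

lemma sum_range_ite_le (f : ℕ → ℝ) {m N : ℕ} (h : m ≤ N) :
    ∑ n ∈ range N, (if m ≤ n then f n - f (n + 1) else 0) = f m - f N := by
  have h1 := sum_range_ite_lt f h
  have h2 : ∑ n ∈ range N, (f n - f (n + 1)) = f 0 - f N := sum_range_sub' f N
  have h3 : ∀ n ∈ range N, f n - f (n + 1) = (if n < m then f n - f (n + 1) else 0) +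
      (if m ≤ n then f n - f (n + 1) else 0) := by
    intro n _
    by_cases hn : n < m
    · simp [hn, not_le.2 hn]
    · simp [hn, not_lt.1 hn]
  rw [sum_congr rfl h3, sum_add_distrib, h1] at h2
  linarith

lemma fib_zero {Z : Type*} [Fintype Z] (a : Z → X) (b : Z → Y) (z : Z) :
    fib univ (fun z => T.run (a z) (b z) 0) z = univ := by
  ext z'; simp [mem_fib, ProtocolTree.run]

/-- The number of bits which player `p` sends in phase `i` in the first `N` rounds. -/
noncomputable def phaseCount (p : Player) (i : Phase) (N : ℕ) (x : X) (y : Y) : ℕ :=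
  count T.toProtocolTree (fun v => T.phase v = i) p N x y

/-- The class of `phaseOne` at `(x, y)` is the class of the transcript at the transition round, so
the losses in the rounds before it telescope. -/
lemma alice_phase_one [Fintype X] (N : ℕ) (y : Y) :
    ∑ x, (log #(univ : Finset X) - log #(fib univ (fun x' => phaseOne T N x' y) x)) ≤
      log 2 * ∑ x, (phaseCount T Player.alice Phase.one N x y : ℝ) := by
  refine le_trans (le_of_eq (sum_congr rfl fun x _ => ?_))
    (sum_log_le_count_alice T.toProtocolTree (fun v => T.phase v = Phase.one) N y)
  have h : fib univ (fun x' => phaseOne T N x' y) x =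
      fib univ (fun x' => T.run x' y (transition T N x y)) x := by
    ext x'; simp only [mem_fib, mem_univ, true_and, phaseOne_eq_iff]
  have h0 : fib univ (fun x' => T.run x' y 0) x = univ := fib_zero T (fun x => x) (fun _ => y) x
  have h1 := sum_range_ite_lt
    (fun n => log #(fib univ (fun x' => T.run x' y n) x)) (transition_le T N x y)
  simp only [h0] at h1
  rw [h, ← h1]
  exact sum_congr rfl fun n hn => by simp only [phase_eq_one_iff T (mem_range.1 hn)]

lemma bob_phase_one [Fintype Y] (N : ℕ) (x : X) :
    ∑ y, (log #(univ : Finset Y) - log #(fib univ (phaseOne T N x) y)) ≤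
      log 2 * ∑ y, (phaseCount T Player.bob Phase.one N x y : ℝ) := by
  refine le_trans (le_of_eq (sum_congr rfl fun y _ => ?_))
    (sum_log_le_count_bob T.toProtocolTree (fun v => T.phase v = Phase.one) N x)
  have h : fib univ (phaseOne T N x) y =
      fib univ (fun y' => T.run x y' (transition T N x y)) y := by
    ext y'; simp only [mem_fib, mem_univ, true_and, phaseOne_eq_iff]
  have h0 : fib univ (fun y' => T.run x y' 0) y = univ := fib_zero T (fun _ => x) (fun y => y) y
  have h1 := sum_range_ite_lt
    (fun n => log #(fib univ (fun y' => T.run x y' n) y)) (transition_le T N x y)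
  simp only [h0] at h1
  rw [h, ← h1]
  exact sum_congr rfl fun n hn => by simp only [phase_eq_one_iff T (mem_range.1 hn)]

lemma alice_phase_two [Fintype X] (N : ℕ) (y : Y) :
    ∑ x, (log #(fib univ (fun x' => phaseOne T N x' y) x) -
        log #(fib univ (fun x' => T.run x' y N) x)) ≤
      log 2 * ∑ x, (phaseCount T Player.alice Phase.two N x y : ℝ) := by
  refine le_trans (le_of_eq (sum_congr rfl fun x _ => ?_))
    (sum_log_le_count_alice T.toProtocolTree (fun v => T.phase v = Phase.two) N y)
  have h : fib univ (fun x' => phaseOne T N x' y) x =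
      fib univ (fun x' => T.run x' y (transition T N x y)) x := by
    ext x'; simp only [mem_fib, mem_univ, true_and, phaseOne_eq_iff]
  rw [h, ← sum_range_ite_le
    (fun n => log #(fib univ (fun x' => T.run x' y n) x)) (transition_le T N x y)]
  exact sum_congr rfl fun n hn => by simp only [phase_eq_two_iff T (mem_range.1 hn)]

lemma bob_phase_two [Fintype Y] (N : ℕ) (x : X) :
    ∑ y, (log #(fib univ (phaseOne T N x) y) - log #(fib univ (fun y' => T.run x y' N) y)) ≤
      log 2 * ∑ y, (phaseCount T Player.bob Phase.two N x y : ℝ) := by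
  refine le_trans (le_of_eq (sum_congr rfl fun y _ => ?_))
    (sum_log_le_count_bob T.toProtocolTree (fun v => T.phase v = Phase.two) N x)
  have h : fib univ (phaseOne T N x) y =
      fib univ (fun y' => T.run x y' (transition T N x y)) y := by
    ext y'; simp only [mem_fib, mem_univ, true_and, phaseOne_eq_iff]
  rw [h, ← sum_range_ite_le
    (fun n => log #(fib univ (fun y' => T.run x y' n) y)) (transition_le T N x y)]
  exact sum_congr rfl fun n hn => by simp only [phase_eq_two_iff T (mem_range.1 hn)]

end Phases

/-! ### Deterministic protocols and the choice of constants -/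

section Deterministic

variable {α : Type*} [Fintype α] {k l : ℕ}
  {T : TwoPhaseTree (Fin k ↪ α) (Fin l ↪ α) (Finset α)} {N : ℕ}

lemma protocol_bound (hk : 2 * k ≤ Fintype.card α)
    (hT : ∀ x y, T.outA (T.run x y N) x = entries x ∩ entries y ∧
      T.outB (T.run x y N) y = entries x ∩ entries y) {M : ℝ} (hM : 0 ≤ M) :
    log (1 + M) * (k * l * ∑ _x : Fin k ↪ α, ∑ _y : Fin l ↪ α, (1 - 6 * l / Fintype.card α : ℝ) -
        2 * l * (log 2 * ∑ x, ∑ y, (phaseCount T Player.alice Phase.one N x y : ℝ)) -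
        40 / 3 * k * (log 2 * ∑ x, ∑ y, (phaseCount T Player.bob Phase.one N x y : ℝ))) ≤
      l * (log 2 * ∑ x, ∑ y, (phaseCount T Player.alice Phase.one N x y : ℝ) +
          log 2 * ∑ x, ∑ y, (phaseCount T Player.alice Phase.two N x y : ℝ)) +
        8 * M * k * (log 2 * ∑ x, ∑ y, (phaseCount T Player.bob Phase.two N x y : ℝ)) := by
  have h := partition_bound hk (isRect_phaseOne T N) (isRect_run T.toProtocolTree N)
    (fun x y x' y' => phaseOne_eq_of_run T) (fun x y x' y' => outputs_inter_eq hT) hM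
  have a1 := sum_le_sum fun y (_ : y ∈ univ) => alice_phase_one T N y
  have a2 := sum_le_sum fun y (_ : y ∈ univ) => alice_phase_two T N y
  have b1 := sum_le_sum fun x (_ : x ∈ univ) => bob_phase_one T N x
  have b2 := sum_le_sum fun x (_ : x ∈ univ) => bob_phase_two T N x
  rw [sum_comm, ← mul_sum, sum_comm (f := fun y x => (phaseCount T _ _ N x y : ℝ))] at a1 a2
  rw [← mul_sum] at b1 b2
  have hlog : 0 ≤ log (1 + M) := log_nonneg (by linarith)
  have a3 : ∑ x, ∑ y, (log #(univ : Finset (Fin k ↪ α)) -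
      log #(fib univ (fun x' => T.run x' y N) x)) ≤
      log 2 * ∑ x, ∑ y, (phaseCount T Player.alice Phase.one N x y : ℝ) +
        log 2 * ∑ x, ∑ y, (phaseCount T Player.alice Phase.two N x y : ℝ) := by
    refine le_trans (le_of_eq ?_) (add_le_add a1 a2)
    simp only [← sum_add_distrib]
    exact sum_congr rfl fun x _ => sum_congr rfl fun y _ => by ring
  refine le_trans (mul_le_mul_of_nonneg_left ?_ hlog) (h.trans ?_)
  · gcongr
  · gcongr

lemma not_cheap (hk : 1 ≤ k) (hkl : k ≤ l) (hU : 100 * l ≤ Fintype.card α)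
    (hT : ∀ x y, T.outA (T.run x y N) x = entries x ∩ entries y ∧
      T.outB (T.run x y N) y = entries x ∩ entries y) {r : ℝ} (hr : 1 < r)
    {n : ℝ} (hn : n = Fintype.card (Fin k ↪ α) * Fintype.card (Fin l ↪ α)) {ε : ℝ}
    (hε : ε ≤ 1 / 10000)
    (hA1 : ∑ x, ∑ y, (phaseCount T Player.alice Phase.one N x y : ℝ) ≤ 4 * n * (ε * k))
    (hB1 : ∑ x, ∑ y, (phaseCount T Player.bob Phase.one N x y : ℝ) ≤ 4 * n * (ε * l))
    (hA2 : ∑ x, ∑ y, (phaseCount T Player.alice Phase.two N x y : ℝ) ≤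
      4 * n * (ε * (k * logb 2 r)))
    (hB2 : ∑ x, ∑ y, (phaseCount T Player.bob Phase.two N x y : ℝ) ≤ 4 * n * (ε * (k / r))) :
    False := by
  -- Taking `M` of order `r` offsets the factor `1 / r` in Bob's second budget. The factor `100`
  -- gives `log (1 + M) ≥ log r + 4`, and the constant `4` keeps the main term dominant for `r`
  -- close to `1`.
  have h := protocol_bound (N := N) (by omega) hT (M := 100 * r) (by linarith)
  have hk0 : (1 : ℝ) ≤ k := by exact_mod_cast hk
  have hkl0 : (k : ℝ) ≤ l := by exact_mod_cast hkl
  have hU0 : (100 * l : ℝ) ≤ Fintype.card α := by exact_mod_cast hU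
  have hUpos : (0 : ℝ) < Fintype.card α := by linarith
  have hnpos : 0 < n := by
    rw [hn]
    have h1 : Nonempty (Fin k ↪ α) := Function.Embedding.nonempty_of_card_le (by simp; omega)
    have h2 : Nonempty (Fin l ↪ α) := Function.Embedding.nonempty_of_card_le (by simp; omega)
    exact_mod_cast Nat.mul_pos Fintype.card_pos Fintype.card_pos
  have hlr : 0 < log r := log_pos hr
  have hl2 := log_two_gt_d9
  have hl2' := log_two_lt_d9
  have hlogb : log 2 * logb 2 r = log r := by
    rw [mul_comm, logb, div_mul_cancel₀ _ (by linarith)]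
  have hlM : log r + 4 ≤ log (1 + 100 * r) := by
    have h1 : log (64 * r) = 6 * log 2 + log r := by
      rw [log_mul (by norm_num) (by linarith), show (64 : ℝ) = 2 ^ 6 by norm_num, log_pow]
      norm_num
    have h2 : log (64 * r) ≤ log (1 + 100 * r) := log_le_log (by linarith) (by linarith)
    linarith
  have hfrac : (6 * l / Fintype.card α : ℝ) ≤ 6 / 100 := by
    rw [div_le_div_iff₀ hUpos (by norm_num)]; linarith
  simp only [sum_const, nsmul_eq_mul, card_univ] at h
  rw [← mul_assoc (Fintype.card (Fin k ↪ α) : ℝ), ← hn] at h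
  generalize (∑ x, ∑ y, (phaseCount T Player.alice Phase.one N x y : ℝ)) = A1 at *
  generalize (∑ x, ∑ y, (phaseCount T Player.bob Phase.one N x y : ℝ)) = B1 at *
  generalize (∑ x, ∑ y, (phaseCount T Player.alice Phase.two N x y : ℝ)) = A2 at *
  generalize (∑ x, ∑ y, (phaseCount T Player.bob Phase.two N x y : ℝ)) = B2 at *
  generalize (6 * l / Fintype.card α : ℝ) = q at *
  clear hT hn
  generalize (k : ℝ) = K at *
  generalize (l : ℝ) = L at *
  have hK : 0 < K := by linarith
  have hL : 0 < L := by linarith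
  have hKLn : 0 < K * L * n := by positivity
  have e1 : L * (log 2 * A1) ≤ 4 * ε * log 2 * (K * L * n) := by
    have := mul_le_mul_of_nonneg_left hA1 (by positivity : 0 ≤ L * log 2)
    linarith
  have e2 : K * (log 2 * B1) ≤ 4 * ε * log 2 * (K * L * n) := by
    have := mul_le_mul_of_nonneg_left hB1 (by positivity : 0 ≤ K * log 2)
    linarith
  have e3 : L * (log 2 * A2) ≤ 4 * ε * log r * (K * L * n) := by
    have := mul_le_mul_of_nonneg_left hA2 (by positivity : 0 ≤ L * log 2)
    have h2 : L * log 2 * (4 * n * (ε * (K * logb 2 r))) =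
      4 * ε * (log 2 * logb 2 r) * (K * L * n) := by ring
    rw [h2, hlogb] at this
    linarith
  have e4 : r * K * (log 2 * B2) ≤ 4 * ε * log 2 * (K * K * n) := by
    have := mul_le_mul_of_nonneg_left hB2 (by positivity : 0 ≤ r * K * log 2)
    have h2 : r * K * log 2 * (4 * n * (ε * (K / r))) = 4 * ε * log 2 * (K * K * n) := by
      field_simp
    rw [h2] at this
    linarith
  have f1 : 4 * ε * log 2 ≤ 4 / 10000 := by nlinarith
  have f2 : 4 * ε * log r ≤ 4 / 10000 * log r := by nlinarith
  have f3 : K * K * n ≤ K * L * n := by gcongr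
  have g1 := e1.trans (mul_le_mul_of_nonneg_right f1 hKLn.le)
  have g2 := e2.trans (mul_le_mul_of_nonneg_right f1 hKLn.le)
  have g3 := e3.trans (mul_le_mul_of_nonneg_right f2 hKLn.le)
  have g4 : r * K * (log 2 * B2) ≤ 4 / 10000 * (K * L * n) :=
    (e4.trans (mul_le_mul_of_nonneg_right f1 (by positivity))).trans
      (mul_le_mul_of_nonneg_left f3 (by norm_num))
  -- The losses are at most `6 / 100` from `l / U` and `(2 + 40 / 3) * 4 / 10000` from phase one,
  -- together below `1 / 10`.
  have g5 : K * L * n * (9 / 10) ≤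
      K * L * (n * (1 - q)) - 2 * L * (log 2 * A1) - 40 / 3 * K * (log 2 * B1) := by
    have := mul_le_mul_of_nonneg_left hfrac hKLn.le
    linarith
  have g6 := mul_le_mul hlM g5 (by positivity) (by linarith)
  have g7 : 0 < K * L * n * log r := by positivity
  linarith

end Deterministic

/-! ### Protocols with fixed coins acting on sequences -/

section Pullback

variable {X Y α β γ : Type*}

/-- The tree in which the players act on `f x` and `g y`. -/
def pullback (T : TwoPhaseTree α β γ) (f : X → α) (g : Y → β) : TwoPhaseTree X Y γ where
  node := T.node
  bitA v x := T.bitA v (f x)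
  bitB v y := T.bitB v (g y)
  outA v x := T.outA v (f x)
  outB v y := T.outB v (g y)
  marked := T.marked
  marked_unique := T.marked_unique

lemma phaseCount_pullback_le (T : TwoPhaseTree α β γ) (f : X → α) (g : Y → β) (p : Player)
    (i : Phase) (N : ℕ) (x : X) (y : Y) :
    (phaseCount (pullback T f g) p i N x y : ℝ≥0∞) ≤ T.bits p i (f x) (g y) := by
  refine le_trans (le_of_eq ?_) (ENNReal.sum_le_tsum (range N))
  rw [phaseCount, count, card_filter, Nat.cast_sum]
  refine sum_congr rfl fun n _ => ?_
  rw [Nat.cast_ite, Nat.cast_one, Nat.cast_zero]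
  exact if_congr and_comm rfl rfl

/-- There are finitely many inputs and a transcript is constant after its leaf, so the latest
halting time serves for all of them. -/
lemma exists_common_halting_time [Finite X] [Finite Y] (T : TwoPhaseTree α β γ) (f : X → α)
    (g : Y → β) (z : X → Y → γ) (h : ∀ x y, T.BothOutput (f x) (g y) (z x y)) :
    ∃ N, ∀ x y, (pullback T f g).outA ((pullback T f g).run x y N) x = z x y ∧
      (pullback T f g).outB ((pullback T f g).run x y N) y = z x y := by
  choose t h1 h2 h3 using h
  obtain ⟨N, hN⟩ := (Set.finite_range fun p : X × Y => t p.1 p.2).bddAbove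
  refine ⟨N, fun x y => ?_⟩
  have hle : t x y ≤ N := hN ⟨(x, y), rfl⟩
  have hrun : T.run (f x) (g y) N = T.run (f x) (g y) (t x y) :=
    run_eq_of_node_eq_none _ hle (h1 x y)
  change T.outA (T.run (f x) (g y) N) (f x) = _ ∧ T.outB (T.run (f x) (g y) N) (g y) = _
  rw [hrun]
  exact ⟨h2 x y, h3 x y⟩

end Pullback

/-! ### Measurability of the number of bits sent -/

section Measurability

variable {α β γ : Type*} (P : TwoPhaseProtocol.{u} α β γ) (x : α) (y : β)

lemma measurableSet_step_eq (v v' : List Bool) :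
    MeasurableSet {ω : P.Pub × P.CoinA × P.CoinB |
      (P.tree ω.1).step (x, ω.2.1) (y, ω.2.2) v = v'} := by
  have hn : ∀ s, MeasurableSet {ω : P.Pub × P.CoinA × P.CoinB | (P.tree ω.1).node v = s} :=
    fun s => measurable_fst (P.measurableSet_node v s)
  have hA : MeasurableSet {ω : P.Pub × P.CoinA × P.CoinB |
      v ++ [(P.tree ω.1).bitA v (x, ω.2.1)] = v'} :=
    ((P.measurable_bitA v x).comp (measurable_fst.prodMk measurable_snd.fst))
      (MeasurableSet.of_discrete (s := {b | v ++ [b] = v'}))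
  have hB : MeasurableSet {ω : P.Pub × P.CoinA × P.CoinB |
      v ++ [(P.tree ω.1).bitB v (y, ω.2.2)] = v'} :=
    ((P.measurable_bitB v y).comp (measurable_fst.prodMk measurable_snd.snd))
      (MeasurableSet.of_discrete (s := {b | v ++ [b] = v'}))
  have : {ω : P.Pub × P.CoinA × P.CoinB | (P.tree ω.1).step (x, ω.2.1) (y, ω.2.2) v = v'} =
      ({ω | (P.tree ω.1).node v = none} ∩ {_ω | v = v'}) ∪
      ({ω | (P.tree ω.1).node v = some Player.alice} ∩
        {ω | v ++ [(P.tree ω.1).bitA v (x, ω.2.1)] = v'}) ∪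
      ({ω | (P.tree ω.1).node v = some Player.bob} ∩
        {ω | v ++ [(P.tree ω.1).bitB v (y, ω.2.2)] = v'}) := by
    ext ω
    rcases h : (P.tree ω.1).node v with _ | _ | _ <;> simp [ProtocolTree.step, h]
  rw [this]
  exact (((hn _).inter (MeasurableSet.const _)).union ((hn _).inter hA)).union ((hn _).inter hB)

lemma measurableSet_run_eq (n : ℕ) (v : List Bool) :
    MeasurableSet {ω : P.Pub × P.CoinA × P.CoinB |
      (P.tree ω.1).run (x, ω.2.1) (y, ω.2.2) n = v} := by
  induction n generalizing v with
  | zero => exact MeasurableSet.const ([] = v)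
  | succ n ih =>
    have : {ω : P.Pub × P.CoinA × P.CoinB | (P.tree ω.1).run (x, ω.2.1) (y, ω.2.2) (n + 1) = v} =
        ⋃ v', {ω | (P.tree ω.1).run (x, ω.2.1) (y, ω.2.2) n = v'} ∩
          {ω | (P.tree ω.1).step (x, ω.2.1) (y, ω.2.2) v' = v} := by
      ext ω
      simp [run_succ]
    rw [this]
    exact MeasurableSet.iUnion fun v' => (ih v').inter (measurableSet_step_eq P x y v' v)

lemma measurableSet_phase_eq (v : List Bool) (i : Phase) :
    MeasurableSet {ω : P.Pub × P.CoinA × P.CoinB | (P.tree ω.1).phase v = i} := by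
  have h2 : MeasurableSet {ω : P.Pub × P.CoinA × P.CoinB |
      ∃ m, m <+: v ∧ m ∈ (P.tree ω.1).marked} := by
    simp only [Set.ofPred_exists]
    exact MeasurableSet.iUnion fun m =>
      (MeasurableSet.const _).inter (measurable_fst (P.measurableSet_marked m))
  cases i with
  | one =>
    convert h2.compl using 1
    ext ω
    simp [TwoPhaseTree.phase]
  | two =>
    convert h2 using 1
    ext ω
    simp [TwoPhaseTree.phase]

lemma measurable_bits (p : Player) (i : Phase) :
    Measurable fun ω : P.Pub × P.CoinA × P.CoinB =>
      (P.tree ω.1).bits p i (x, ω.2.1) (y, ω.2.2) := by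
  refine Measurable.tsum fun n => Measurable.ite ?_ measurable_const measurable_const
  have : {ω : P.Pub × P.CoinA × P.CoinB |
      (P.tree ω.1).node ((P.tree ω.1).run (x, ω.2.1) (y, ω.2.2) n) = some p ∧
        (P.tree ω.1).phase ((P.tree ω.1).run (x, ω.2.1) (y, ω.2.2) n) = i} =
      ⋃ v, {ω | (P.tree ω.1).run (x, ω.2.1) (y, ω.2.2) n = v} ∩
        ({ω | (P.tree ω.1).node v = some p} ∩ {ω | (P.tree ω.1).phase v = i}) := by
    ext ω
    simp
  rw [this]
  exact MeasurableSet.iUnion fun v => (measurableSet_run_eq P x y n v).inter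
    ((measurable_fst (P.measurableSet_node v _)).inter (measurableSet_phase_eq P v i))

end Measurability

/-! ### From sets to sequences, and fixing the coins -/

section Averaging

lemma card_filter_entries {α : Type*} [Fintype α] {k : ℕ} {s : Finset α} (hs : #s = k) :
    #{x : Fin k ↪ α | entries x = s} = k.factorial := by
  have h1 : Fintype.card (Fin k ≃ s) = k.factorial := by
    rw [Fintype.card_equiv (Fintype.equivOfCardEq (by simp [hs])), Fintype.card_fin]
  rw [← h1, ← card_univ]
  symm
  refine card_bij (fun e _ => e.toEmbedding.trans (Function.Embedding.subtype _)) ?_ ?_ ?_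
  · intro e _
    rw [mem_filter]
    refine ⟨mem_univ _, ?_⟩
    ext a
    simp only [entries, mem_map, mem_univ, true_and, Function.Embedding.trans_apply,
      Equiv.coe_toEmbedding, Function.Embedding.subtype_apply]
    constructor
    · rintro ⟨t, rfl⟩; exact (e t).2
    · intro ha; exact ⟨e.symm ⟨a, ha⟩, by simp⟩
  · intro e _ e' _ h
    ext t
    exact DFunLike.congr_fun h t
  · intro x hx
    have hx' := (mem_filter.1 hx).2
    have hm : ∀ t, x t ∈ s := fun t => hx' ▸ mem_map.2 ⟨t, mem_univ _, rfl⟩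
    refine ⟨Equiv.ofBijective (fun t => ⟨x t, hm t⟩) ⟨fun t t' h => ?_, fun a => ?_⟩,
      mem_univ _, ?_⟩
    · exact x.injective (congrArg Subtype.val h)
    · have ha : (a : α) ∈ entries x := by rw [hx']; exact a.2
      rw [entries, mem_map] at ha
      obtain ⟨t, -, ht⟩ := ha
      exact ⟨t, Subtype.ext ht⟩
    · ext t; rfl

/-- Each `k`-set is the set of entries of exactly `k!` injective sequences, so a uniform sequence
induces a uniform set. -/
lemma sum_entries {α : Type*} [Fintype α] (k : ℕ) (F : Finset α → ℝ≥0∞) :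
    ∑ x : Fin k ↪ α, F (entries x) =
      k.factorial * ∑ s ∈ powersetCard k (univ : Finset α), F s := by
  have hm : ∀ x ∈ (univ : Finset (Fin k ↪ α)), entries x ∈ powersetCard k (univ : Finset α) :=
    fun x _ => mem_powersetCard.2 ⟨subset_univ _, by simp [entries]⟩
  rw [← sum_fiberwise_of_maps_to hm, mul_sum]
  refine sum_congr rfl fun s hs => ?_
  have : ∀ x ∈ univ.filter (fun x : Fin k ↪ α => entries x = s), F (entries x) = F s :=
    fun x hx => by rw [(mem_filter.1 hx).2]
  rw [sum_congr rfl this, sum_const, nsmul_eq_mul, card_filter_entries (mem_powersetCard.1 hs).2]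

lemma card_embedding_eq {α : Type*} [Fintype α] (k : ℕ) :
    (Fintype.card (Fin k ↪ α) : ℝ≥0∞) =
      k.factorial * #(powersetCard k (univ : Finset α)) := by
  have := sum_entries (α := α) k (fun _ => 1)
  simpa using this

lemma sum_costOn {U k l : ℕ} (hk : k ≤ U) (hl : l ≤ U)
    (P : TwoPhaseProtocol.{u} (Finset (Fin U)) (Finset (Fin U)) (Finset (Fin U)))
    (p : Player) (i : Phase) :
    ∑ x : Fin k ↪ Fin U, ∑ y : Fin l ↪ Fin U, P.costOn p i (entries x) (entries y) =
      Fintype.card (Fin k ↪ Fin U) * Fintype.card (Fin l ↪ Fin U) *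
        P.cost (unifSetInt U k l hk hl) p i := by
  set S := powersetCard k (univ : Finset (Fin U))
  set S' := powersetCard l (univ : Finset (Fin U))
  have hS : (#S : ℝ≥0∞) ≠ 0 := by
    have : S.Nonempty := powersetCard_nonempty.2 (by simpa using hk)
    exact_mod_cast (card_pos.2 this).ne'
  have hS' : (#S' : ℝ≥0∞) ≠ 0 := by
    have : S'.Nonempty := powersetCard_nonempty.2 (by simpa using hl)
    exact_mod_cast (card_pos.2 this).ne'
  have hcost : P.cost (unifSetInt U k l hk hl) p i =
      (#S * #S' : ℝ≥0∞)⁻¹ * ∑ s ∈ S, ∑ t ∈ S', P.costOn p i s t := by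
    rw [TwoPhaseProtocol.cost, tsum_fintype, ← sum_product', mul_sum,
      ← sum_subset (subset_univ (S ×ˢ S'))]
    · refine sum_congr rfl fun z hz => ?_
      rw [unifSetInt, PMF.uniformOfFinset_apply_of_mem _ hz, card_product, Nat.cast_mul]
    · intro z _ hz
      rw [unifSetInt, PMF.uniformOfFinset_apply_of_notMem _ hz, zero_mul]
  rw [hcost, card_embedding_eq, card_embedding_eq,
    sum_entries k (fun s => ∑ y : Fin l ↪ Fin U, P.costOn p i s (entries y))]
  simp only [sum_entries l, ← mul_sum]
  have : (#S * #S' : ℝ≥0∞) * (#S * #S' : ℝ≥0∞)⁻¹ = 1 :=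
    ENNReal.mul_inv_cancel (mul_ne_zero hS hS')
      (ENNReal.mul_ne_top (ENNReal.natCast_ne_top _) (ENNReal.natCast_ne_top _))
  calc _ = (k.factorial * l.factorial : ℝ≥0∞) * 1 * ∑ s ∈ S, ∑ t ∈ S', P.costOn p i s t := by
        ring
    _ = _ := by rw [← this]; ring

/-- The coins of a Las Vegas protocol can be fixed so that all four average costs are at most four
times the given bounds. -/
lemma exists_tree {U k l : ℕ} (hk : k ≤ U) (hl : l ≤ U)
    (P : TwoPhaseProtocol.{u} (Finset (Fin U)) (Finset (Fin U)) (Finset (Fin U)))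
    (hP : SolvesSetInt U k l P) (t : Player → Phase → ℝ) (ht : ∀ p i, 0 < t p i)
    (hc : ∀ p i, P.cost (unifSetInt U k l hk hl) p i ≤ ENNReal.ofReal (t p i)) :
    ∃ (T : TwoPhaseTree (Fin k ↪ Fin U) (Fin l ↪ Fin U) (Finset (Fin U))) (N : ℕ),
      (∀ x y, T.outA (T.run x y N) x = entries x ∩ entries y ∧
        T.outB (T.run x y N) y = entries x ∩ entries y) ∧
      ∀ p i, ∑ x, ∑ y, (phaseCount T p i N x y : ℝ) ≤
        4 * (Fintype.card (Fin k ↪ Fin U) * Fintype.card (Fin l ↪ Fin U) : ℝ) * t p i := by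
  set pl : Bool → Player := fun b => if b then Player.alice else Player.bob
  set ph : Bool → Phase := fun b => if b then Phase.one else Phase.two
  set n : ℝ≥0∞ := Fintype.card (Fin k ↪ Fin U) * Fintype.card (Fin l ↪ Fin U) with hn
  set S : Player → Phase → P.Pub × P.CoinA × P.CoinB → ℝ≥0∞ := fun p i ω =>
    ∑ x : Fin k ↪ Fin U, ∑ y : Fin l ↪ Fin U,
      (P.tree ω.1).bits p i (entries x, ω.2.1) (entries y, ω.2.2) with hS
  have hSm : ∀ p i, Measurable (S p i) := fun p i =>
    Finset.measurable_fun_sum _ fun x _ => Finset.measurable_fun_sum _ fun y _ =>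
      measurable_bits P _ _ p i
  have hSint : ∀ p i, ∫⁻ ω, S p i ω ∂P.law ≤ n * ENNReal.ofReal (t p i) := by
    intro p i
    have : ∫⁻ ω, S p i ω ∂P.law =
        ∑ x : Fin k ↪ Fin U, ∑ y : Fin l ↪ Fin U, P.costOn p i (entries x) (entries y) := by
      rw [lintegral_finsetSum _ fun x _ => Finset.measurable_fun_sum _ fun y _ =>
        measurable_bits P _ _ p i]
      refine sum_congr rfl fun x _ => ?_
      rw [lintegral_finsetSum _ fun y _ => measurable_bits P _ _ p i]
      rfl
    rw [this, sum_costOn hk hl]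
    gcongr
    exact hc p i
  have ht0 : ∀ p i, ENNReal.ofReal (t p i) ≠ 0 := fun p i => by simpa using ht p i
  -- Each total cost divided by its bound has mean at most `n`. Controlling the sum of the four
  -- controls all of them by the same coins.
  set G : P.Pub × P.CoinA × P.CoinB → ℝ≥0∞ := fun ω =>
    ∑ a : Bool × Bool, S (pl a.1) (ph a.2) ω * (ENNReal.ofReal (t (pl a.1) (ph a.2)))⁻¹
  have hGm : Measurable G := Finset.measurable_fun_sum _ fun a _ => (hSm _ _).mul_const _
  have hGint : ∫⁻ ω, G ω ∂P.law ≤ 4 * n := by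
    rw [lintegral_finsetSum _ fun a _ => (hSm _ _).mul_const _]
    have : ∀ a ∈ (univ : Finset (Bool × Bool)),
        ∫⁻ ω, S (pl a.1) (ph a.2) ω * (ENNReal.ofReal (t (pl a.1) (ph a.2)))⁻¹ ∂P.law ≤ n := by
      intro a _
      rw [lintegral_mul_const _ (hSm _ _), ← div_eq_mul_inv]
      exact ENNReal.div_le_of_le_mul (hSint _ _)
    refine (sum_le_sum this).trans (le_of_eq ?_)
    simp [Fintype.card_prod]
  have hae : ∀ᵐ ω ∂P.law, ∀ (x : Fin k ↪ Fin U) (y : Fin l ↪ Fin U),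
      (P.tree ω.1).BothOutput (entries x, ω.2.1) (entries y, ω.2.2) (entries x ∩ entries y) := by
    rw [ae_all_iff]
    intro x
    rw [ae_all_iff]
    intro y
    have := hP (entries x) (entries y) (by simp [entries]) (by simp [entries])
    unfold TwoPhaseProtocol.ZeroError at this
    convert this
  have : IsProbabilityMeasure P.law := by unfold TwoPhaseProtocol.law; infer_instance
  -- The inputs are finitely many, so almost surely all answers are correct; some coins off this
  -- null set also give `G` at most its mean.
  obtain ⟨ω, hω, hGω⟩ := exists_notMem_null_le_lintegral hGm.aemeasurable (ae_iff.1 hae)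
  have hω' : ∀ (x : Fin k ↪ Fin U) (y : Fin l ↪ Fin U),
      (P.tree ω.1).BothOutput (entries x, ω.2.1) (entries y, ω.2.2) (entries x ∩ entries y) := by
    simpa using hω
  obtain ⟨N, hN⟩ := exists_common_halting_time (P.tree ω.1)
    (fun x : Fin k ↪ Fin U => (entries x, ω.2.1)) (fun y : Fin l ↪ Fin U => (entries y, ω.2.2))
    (fun x y => entries x ∩ entries y) hω'
  refine ⟨_, N, hN, fun p i => ?_⟩
  obtain ⟨a, rfl, rfl⟩ : ∃ a : Bool × Bool, pl a.1 = p ∧ ph a.2 = i := by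
    cases p <;> cases i
    exacts [⟨(true, true), rfl, rfl⟩, ⟨(true, false), rfl, rfl⟩, ⟨(false, true), rfl, rfl⟩,
      ⟨(false, false), rfl, rfl⟩]
  have h1 : S (pl a.1) (ph a.2) ω ≤ 4 * n * ENNReal.ofReal (t (pl a.1) (ph a.2)) := by
    have h2 : S (pl a.1) (ph a.2) ω * (ENNReal.ofReal (t (pl a.1) (ph a.2)))⁻¹ ≤ 4 * n :=
      (single_le_sum (f := fun a : Bool × Bool =>
        S (pl a.1) (ph a.2) ω * (ENNReal.ofReal (t (pl a.1) (ph a.2)))⁻¹)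
        (fun _ _ => zero_le) (mem_univ a)).trans (hGω.trans hGint)
    rw [← div_eq_mul_inv] at h2
    exact (ENNReal.div_le_iff (ht0 _ _) ENNReal.ofReal_ne_top).1 h2
  have h3 := (sum_le_sum fun x (_ : x ∈ univ) => sum_le_sum fun y (_ : y ∈ univ) =>
    phaseCount_pullback_le (P.tree ω.1) (fun x : Fin k ↪ Fin U => (entries x, ω.2.1))
      (fun y : Fin l ↪ Fin U => (entries y, ω.2.2)) (pl a.1) (ph a.2) N x y).trans h1
  have h4 : 4 * n * ENNReal.ofReal (t (pl a.1) (ph a.2)) = ENNReal.ofReal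
      (4 * (Fintype.card (Fin k ↪ Fin U) * Fintype.card (Fin l ↪ Fin U) : ℝ) *
        t (pl a.1) (ph a.2)) := by
    rw [ENNReal.ofReal_mul (by positivity), ENNReal.ofReal_mul (by positivity),
      ENNReal.ofReal_mul (by positivity), ENNReal.ofReal_natCast, ENNReal.ofReal_natCast]
    norm_num [hn]
  rw [h4] at h3
  have h5 := ENNReal.toReal_le_of_le_ofReal (by have := (ht (pl a.1) (ph a.2)).le; positivity) h3
  simp only [← Nat.cast_sum, ENNReal.toReal_natCast] at h5 ⊢
  exact h5

end Averaging

end SetIntBound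

/-! ### The lower bound for Las Vegas protocols -/

open SetIntBound in
theorem lemma1 :
    ∃ ε : ℝ, 0 < ε ∧ ∃ C : ℝ,
      ∀ (U k l : ℕ) (hk : k ≤ U) (hl : l ≤ U),
        1 ≤ k → C * k ≤ l → C * l ≤ U →
        ∀ r : ℝ, 1 < r →
        ∀ P : TwoPhaseProtocol.{u} (Finset (Fin U)) (Finset (Fin U)) (Finset (Fin U)),
          SolvesSetInt U k l P →
          ¬ (P.cost (unifSetInt U k l hk hl) Player.alice Phase.one ≤ ENNReal.ofReal (ε * k) ∧
             P.cost (unifSetInt U k l hk hl) Player.bob Phase.one ≤ ENNReal.ofReal (ε * l) ∧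
             P.cost (unifSetInt U k l hk hl) Player.alice Phase.two
               ≤ ENNReal.ofReal (ε * (k * Real.logb 2 r)) ∧
             P.cost (unifSetInt U k l hk hl) Player.bob Phase.two
               ≤ ENNReal.ofReal (ε * (k / r))) := by
  refine ⟨1 / 10000, by norm_num, 100, ?_⟩
  rintro U k l hk hl hk1 hkl hlU r hr P hP ⟨hA1, hB1, hA2, hB2⟩
  have hk0 : (0 : ℝ) < k := by exact_mod_cast hk1
  have hl0 : (0 : ℝ) < l := by linarith
  have hr0 : (0 : ℝ) < r := by linarith
  have hlog : 0 < Real.logb 2 r := Real.logb_pos (by norm_num) hr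
  let t : Player → Phase → ℝ
    | .alice, .one => 1 / 10000 * k
    | .bob, .one => 1 / 10000 * l
    | .alice, .two => 1 / 10000 * (k * Real.logb 2 r)
    | .bob, .two => 1 / 10000 * (k / r)
  obtain ⟨T, N, hT, hcount⟩ := exists_tree hk hl P hP t
    (by rintro (_ | _) (_ | _) <;> simp only [t] <;> positivity)
    (by rintro (_ | _) (_ | _) <;> assumption)
  exact not_cheap hk1 (by exact_mod_cast (by linarith : (k : ℝ) ≤ l))
    (by rw [Fintype.card_fin]; exact_mod_cast hlU) (fun x y => by convert hT x y) hr rfl le_rfl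
    (hcount .alice .one) (hcount .bob .one) (hcount .alice .two) (hcount .bob .two)
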